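/- \textbf{Conventions.} For a self-map $g$ of a space $Y$, the solenoid of $(Y,g)$ is the inverse limit $\varprojlim(Y,g)=\{(y_n)_{n\ge 0}: g(y_{n+1})=y_n\}$ with the topology induced by the product topology and the map $(y_n)_n\mapsto(g(y_n))_n$. A conjugacy is a homeomorphism that intertwines the two maps. A system $(X,\varphi)$ is irreducible if for all nonempty open $U,V$ there is $n>0$ with $\varphi^n(U)\cap V\neq\emptyset$. A map $\tilde g:\tilde Y\to\tilde Y$ is forward orbit expansive if there is a finite open cover $\{U_i\}$ of $\tilde Y$ such that $x=y$ whenever for every $n\ge0$ some $U_i$ contains both $\tilde g^n(x)$ and $\tilde g^n(y)$. \textbf{Setting.} Let $(Y,d_Y)$ be an infinite compact metric space and let $g:Y\to Y$ be a continuous surjection satisfying Wieler's axioms with constants $\beta>0$, $0<\gamma<1$ and an integer $K\ge 1$: if $d_Y(x,y)\le\beta$ then $d_Y(g^K(x),g^K(y))\le\gamma^K d_Y(g^{2K}(x),g^{2K}(y))$; and $g^K(B(g^K(x),\epsilon))\subseteq g^{2K}(B(x,\gamma\epsilon))$ for all $x\in Y$ and $0<\epsilon\le\beta$. Let $(X,\varphi)$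 be the solenoid of $(Y,g)$ (the Wieler solenoid), with the metric $d_X(x,y)=\sum_{i=0}^{K}\gamma^i\sup_n\gamma^n d_Y(\varphi^i(x)_n,\varphi^i(y)_n)$. Put $$X^u(x,\epsilon)=\{y\in X: d_Y(x_n,y_n)<\epsilon\ \text{for all } n,\ d_X(x,y)<\epsilon\}.$$ Let $P\subset X$ be a finite $\varphi$-invariant set of periodic points, and let $X^u(P)$ be the set of $x\in X$ such that $d_X(\varphi^{-n}(x),\varphi^{-n}(p))\to0$ for some $p\in P$, with the topology in which the sets $X^u(x,\delta)$, $\delta>0$ small, form a neighbourhood base at $x$. Fix $0<\epsilon_Y\le\beta/2$ and write $\pi_0(x)=x_0$. For $x,y\in X^u(P)$ write $x\sim_0y$ if $x_0=y_0$ and there are $0<\delta<\epsilon_Y$ and an open $U\subseteq X^u(y,\epsilon_Y)$ with $\pi_0(X^u(x,\delta))=\pi_0(U)$. Give $X^u(P)/{\sim_0}$ the quotient topology. \textbf{Theorem.} (1) If $(X,\varphi)$ is irreducible and $P\ne\emptyset$, then $X^u(P)$ is dense in $X$. (2) Suppose that $X^u(P)$ is dense in $X$. Then $\sim_0$ is an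 equivalence relation; $\tilde g([x]_0)=[\varphi(x)]_0$ gives a well-defined continuous map $\tilde g$ of $X^u(P)/{\sim_0}$ to itself; $r([x]_0)=x_0$ gives a well-defined continuous surjection $r:X^u(P)/{\sim_0}\to Y$; and there is an integer $K_0>0$ such that, for $x,y\in X^u(P)$, $$x_i=y_i \text{ for } 0\le i\le K_0\ \Longrightarrow\ x\sim_0y.\qquad(*)$$ Moreover, for every integer $K_0\ge 0$ with the property $(*)$, the map $s:Y\to X^u(P)/{\sim_0}$, $$s(y)=[(g^{K_0}(y),g^{K_0-1}(y),\ldots,g(y),y,\ldots)]_0$$ (where the sequence is completed to any element of $X^u(P)$), is well defined and continuous, and $r$ and $s$ form a shift equivalence between $(X^u(P)/{\sim_0},\tilde g)$ and $(Y,g)$: $$r\circ\tilde g=g\circ r,\quad s\circ g=\tilde g\circ s,\quad r\circ s=g^{K_0},\quad s\circ r=\tilde g^{K_0};$$ and the map $S(y_0,y_1,y_2,\ldots)=(s(y_0),s(y_1),s(y_2),\ldots)$ is a conjugacy from $(X,\varphi)$ to the solenoid of $(X^u(P)/{\sim_0},\tilde g)$. (3) Let $(X,\varphi)$ be an irreducible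 Smale space, where $X$ is an infinite compact metric space, whose stable sets $X^s(x)$ are totally disconnected (in their locally compact topology, in which the local stable sets form neighbourhood bases). Then there are a compact (possibly non-Hausdorff) space $\tilde Y$ and a forward orbit expansive, surjective local homeomorphism $\tilde g:\tilde Y\to\tilde Y$ such that $(X,\varphi)$ is conjugate to the solenoid of $(\tilde Y,\tilde g)$. -/

import Mathlib

open Filter Topology Set

namespace Wieler

noncomputable section

/-! ### Topological dynamics: inverse limits, conjugacy, shift equivalence, expansiveness -/

/-- The inverse limit (solenoid) of `g : Y → Y`: sequences `(y₀, y₁, …)` with `g (y_{i+1}) = y_i`.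
It carries the topology induced by the product topology. -/
abbrev InverseLimit {Y : Type*} (g : Y → Y) : Type _ :=
  {x : ℕ → Y // ∀ i, g (x (i + 1)) = x i}

/-- The map `φ (x₀, x₁, …) = (g x₀, g x₁, …) = (g x₀, x₀, x₁, …)` on the inverse limit; its inverse
drops the first entry. -/
def shift {Y : Type*} (g : Y → Y) : InverseLimit g ≃ InverseLimit g where
  toFun x := ⟨fun n => g (x.1 n), fun i => congrArg g (x.2 i)⟩
  invFun x := ⟨fun n => x.1 (n + 1), fun i => x.2 (i + 1)⟩
  left_inv x := Subtype.ext (funext fun n => x.2 n)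
  right_inv x := Subtype.ext (funext fun n => x.2 n)

/-- `S` is a (topological) conjugacy from `(A, f)` to `(B, h)`. -/
def IsConjugacy {A B : Type*} [TopologicalSpace A] [TopologicalSpace B]
    (f : A → A) (h : B → B) (S : A → B) : Prop :=
  IsHomeomorph S ∧ Function.Semiconj S f h

/-- The continuous maps `r : A → B` and `s : B → A` form a shift equivalence of lag `L` between
`(A, f)` and `(B, h)`. -/
structure IsShiftEquivalence {A B : Type*} [TopologicalSpace A] [TopologicalSpace B]
    (f : A → A) (h : B → B) (r : A → B) (s : B → A) (L : ℕ) : Prop where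
  continuous_r : Continuous r
  continuous_s : Continuous s
  r_comp : r ∘ f = h ∘ r
  s_comp : s ∘ h = f ∘ s
  r_comp_s : r ∘ s = h^[L]
  s_comp_r : s ∘ r = f^[L]

/-- Forward orbit expansiveness, through a finite open cover. -/
def ForwardOrbitExpansive {Y : Type*} [TopologicalSpace Y] (g : Y → Y) : Prop :=
  ∃ (l : ℕ) (U : Fin l → Set Y), (∀ i, IsOpen (U i)) ∧ (⋃ i, U i) = univ ∧
    ∀ x y : Y, (∀ n : ℕ, ∃ i, g^[n] x ∈ U i ∧ g^[n] y ∈ U i) → x = y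

/-- Irreducibility of a dynamical system: for every ordered pair of nonempty open sets `U`, `V`
there is `n > 0` with `φⁿ(U) ∩ V ≠ ∅`. -/
def IsIrreducibleSystem {X : Type*} [TopologicalSpace X] (φ : X → X) : Prop :=
  ∀ U V : Set X, IsOpen U → IsOpen V → U.Nonempty → V.Nonempty →
    ∃ n : ℕ, 0 < n ∧ ((φ^[n] '' U) ∩ V).Nonempty

/-! ### Smale spaces -/

/-- A Smale space structure on the metric space `X` with the homeomorphism `φ`. The bracket is only
meaningful on `{(x, y) | dist x y ≤ ε}`, and the axioms are imposed only where all the brackets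
that occur in them are defined. -/
structure SmaleSpace {X : Type*} [MetricSpace X] (φ : X ≃ₜ X) where
  ε : ℝ
  lam : ℝ
  bracket : X → X → X
  ε_pos : 0 < ε
  lam_pos : 0 < lam
  lam_lt_one : lam < 1
  continuousOn_bracket :
    ContinuousOn (fun p : X × X => bracket p.1 p.2) {p | dist p.1 p.2 ≤ ε}
  B1 : ∀ x, bracket x x = x
  B2 : ∀ x y z, dist y z ≤ ε → dist x (bracket y z) ≤ ε → dist x z ≤ ε →
    bracket x (bracket y z) = bracket x z
  B3 : ∀ x y z, dist x y ≤ ε → dist (bracket x y) z ≤ ε → dist x z ≤ ε →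
    bracket (bracket x y) z = bracket x z
  B4 : ∀ x y, dist x y ≤ ε → dist (φ x) (φ y) ≤ ε →
    φ (bracket x y) = bracket (φ x) (φ y)
  C1 : ∀ x y, dist x y ≤ ε → bracket x y = y → dist (φ x) (φ y) ≤ lam * dist x y
  C2 : ∀ x y, dist x y ≤ ε → bracket x y = x → dist (φ.symm x) (φ.symm y) ≤ lam * dist x y

namespace SmaleSpace

variable {X : Type*} [MetricSpace X] {φ : X ≃ₜ X}

/-- The local stable set `X^s(x, δ)` (for `δ ≤ ε`). -/
def localStable (S : SmaleSpace φ) (x : X) (δ : ℝ) : Set X :=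
  {y | S.bracket x y = y ∧ dist x y < δ}

/-- The global stable set `X^s(x)`, as a type, so that it does not receive the subspace topology. -/
structure StableSet (S : SmaleSpace φ) (x : X) where
  val : X
  mem : Tendsto (fun n : ℕ => dist (φ^[n] val) (φ^[n] x)) atTop (𝓝 0)

/-- The locally compact topology of `X^s(x)`, in which the sets `X^s(y, δ)` form a neighbourhood
base at `y`. -/
instance (S : SmaleSpace φ) (x : X) : TopologicalSpace (S.StableSet x) where
  IsOpen U := ∀ y ∈ U, ∃ δ > 0, ∀ z : S.StableSet x, z.val ∈ S.localStable y.val δ → z ∈ U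
  isOpen_univ := fun _ _ => ⟨1, one_pos, fun _ _ => trivial⟩
  isOpen_inter := by
    rintro U V hU hV y ⟨hyU, hyV⟩
    obtain ⟨a, ha, hUa⟩ := hU y hyU
    obtain ⟨b, hb, hVb⟩ := hV y hyV
    exact ⟨min a b, lt_min ha hb, fun z hz =>
      ⟨hUa z ⟨hz.1, hz.2.trans_le (min_le_left _ _)⟩,
        hVb z ⟨hz.1, hz.2.trans_le (min_le_right _ _)⟩⟩⟩
  isOpen_sUnion := by
    rintro 𝒰 h𝒰 y ⟨U, hU, hy⟩
    obtain ⟨δ, hδ, h⟩ := h𝒰 U hU y hy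
    exact ⟨δ, hδ, fun z hz => ⟨U, hU, h z hz⟩⟩

end SmaleSpace

/-! ### Wieler's axioms and Wieler solenoids -/

/-- `(Y, d, g)` satisfies Wieler's axioms with constants `β`, `γ`, `K`. -/
structure WielerAxioms {Y : Type*} [MetricSpace Y] (g : Y → Y) (β γ : ℝ) (K : ℕ) : Prop where
  continuous : Continuous g
  surjective : Function.Surjective g
  β_pos : 0 < β
  γ_pos : 0 < γ
  γ_lt_one : γ < 1
  K_pos : 0 < K
  axiom1 : ∀ x y, dist x y ≤ β →
    dist (g^[K] x) (g^[K] y) ≤ γ ^ K * dist (g^[2 * K] x) (g^[2 * K] y)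
  axiom2 : ∀ x ε, 0 < ε → ε ≤ β →
    g^[K] '' Metric.ball (g^[K] x) ε ⊆ g^[2 * K] '' Metric.ball x (γ * ε)

section Solenoid

variable {Y : Type*} [MetricSpace Y] {g : Y → Y}

/-- `d'_X(x, y) = sup_n γⁿ d_Y(x_n, y_n)`. -/
def distX' (γ : ℝ) (x y : InverseLimit g) : ℝ :=
  ⨆ n : ℕ, γ ^ n * dist (x.1 n) (y.1 n)

/-- `d_X(x, y) = ∑_{i=0}^{K} γⁱ d'_X(φⁱ x, φⁱ y)`. -/
def distX (γ : ℝ) (K : ℕ) (x y : InverseLimit g) : ℝ :=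
  ∑ i ∈ Finset.range (K + 1), γ ^ i * distX' γ ((shift g)^[i] x) ((shift g)^[i] y)

/-- Unstable equivalence `x ∼_u y`: `d_X(φ⁻ⁿ x, φ⁻ⁿ y) → 0`. -/
def UnstableEquiv (γ : ℝ) (K : ℕ) (x y : InverseLimit g) : Prop :=
  Tendsto (fun n : ℕ => distX γ K ((shift g).symm^[n] x) ((shift g).symm^[n] y)) atTop (𝓝 0)

/-- The local unstable set `X^u(x, ε)` of a Wieler solenoid, for `0 < ε ≤ β / 2`. -/
def localUnstable (γ : ℝ) (K : ℕ) (x : InverseLimit g) (ε : ℝ) : Set (InverseLimit g) :=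
  {y | (∀ n, dist (x.1 n) (y.1 n) < ε) ∧ distX γ K x y < ε}

/-- `X^u(P) = {x | x ∼_u p for some p ∈ P}` as a subset of `X`. -/
def unstableSet (γ : ℝ) (K : ℕ) (P : Set (InverseLimit g)) : Set (InverseLimit g) :=
  {x | ∃ p ∈ P, UnstableEquiv γ K x p}

/-- `X^u(P)` as a space of its own; it does not carry the subspace topology. -/
structure XuP (γ : ℝ) (K : ℕ) (P : Set (InverseLimit g)) where
  val : InverseLimit g
  mem : val ∈ unstableSet γ K P

/-- The locally compact topology of `X^u(P)`, in which the sets `X^u(x, δ)` form a neighbourhood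
base at `x`. -/
instance (γ : ℝ) (K : ℕ) (P : Set (InverseLimit g)) : TopologicalSpace (XuP γ K P) where
  IsOpen U := ∀ x ∈ U, ∃ δ > 0, ∀ y : XuP γ K P, y.val ∈ localUnstable γ K x.val δ → y ∈ U
  isOpen_univ := fun _ _ => ⟨1, one_pos, fun _ _ => trivial⟩
  isOpen_inter := by
    rintro U V hU hV x ⟨hxU, hxV⟩
    obtain ⟨a, ha, hUa⟩ := hU x hxU
    obtain ⟨b, hb, hVb⟩ := hV x hxV
    exact ⟨min a b, lt_min ha hb, fun y hy =>
      ⟨hUa y ⟨fun n => (hy.1 n).trans_le (min_le_left _ _), hy.2.trans_le (min_le_left _ _)⟩,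
        hVb y ⟨fun n => (hy.1 n).trans_le (min_le_right _ _), hy.2.trans_le (min_le_right _ _)⟩⟩⟩
  isOpen_sUnion := by
    rintro 𝒰 h𝒰 x ⟨U, hU, hx⟩
    obtain ⟨δ, hδ, h⟩ := h𝒰 U hU x hx
    exact ⟨δ, hδ, fun y hy => ⟨U, hU, h y hy⟩⟩

/-- The projection `π₀ : X^u(P) → Y`, `x ↦ x₀`. -/
def pi0 {γ : ℝ} {K : ℕ} {P : Set (InverseLimit g)} (x : XuP γ K P) : Y := x.val.1 0

theorem unstableEquiv_shift {γ : ℝ} {K : ℕ} {x y : InverseLimit g} (h : UnstableEquiv γ K x y) :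
    UnstableEquiv γ K (shift g x) (shift g y) := by
  unfold UnstableEquiv at h ⊢
  rw [← tendsto_add_atTop_iff_nat 1]
  simpa only [Function.iterate_succ_apply, Equiv.symm_apply_apply] using h

/-- The restriction of `φ` to `X^u(P)`, for a `φ`-invariant set `P`. -/
def shiftU {γ : ℝ} {K : ℕ} {P : Set (InverseLimit g)} (hP : shift g '' P = P) (x : XuP γ K P) :
    XuP γ K P :=
  ⟨shift g x.val, by
    obtain ⟨p, hp, h⟩ := x.mem
    exact ⟨shift g p, hP ▸ mem_image_of_mem _ hp, unstableEquiv_shift h⟩⟩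

/-- The relation `x ∼₀ y` on `X^u(P)`, with the constant `εY`. -/
def SimZero {γ : ℝ} {K : ℕ} {P : Set (InverseLimit g)} (εY : ℝ) (x y : XuP γ K P) : Prop :=
  pi0 x = pi0 y ∧
    ∃ δ : ℝ, 0 < δ ∧ δ < εY ∧ ∃ U : Set (XuP γ K P),
      IsOpen U ∧ (∀ u ∈ U, u.val ∈ localUnstable γ K y.val εY) ∧
        pi0 '' {w : XuP γ K P | w.val ∈ localUnstable γ K x.val δ} = pi0 '' U

/-- The quotient `X^u(P)/∼₀`, with the quotient topology. -/
abbrev XuPQuot (γ : ℝ) (K : ℕ) (P : Set (InverseLimit g)) (εY : ℝ) : Type _ :=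
  Quot (SimZero (γ := γ) (K := K) (P := P) εY)

/-- The class `[x]₀` of `x ∈ X^u(P)`. -/
def cls {γ : ℝ} {K : ℕ} {P : Set (InverseLimit g)} (εY : ℝ) (x : XuP γ K P) :
    XuPQuot γ K P εY :=
  Quot.mk _ x

/-- The map `r : X^u(P)/∼₀ → Y`, `[x]₀ ↦ x₀`. -/
def rMap (γ : ℝ) (K : ℕ) (P : Set (InverseLimit g)) (εY : ℝ) : XuPQuot γ K P εY → Y :=
  Quot.lift pi0 fun _ _ h => h.1

end Solenoid

end

end Wieler

universe u v

open Wieler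

/-!
The theorem has two independent halves.

**Wieler solenoids.** The leaf topology of `X^u(P)` is that of uniform convergence of coordinates
(`WielerAxioms.mem_nhds_iff`). Wieler's first axiom says that on points whose coordinates are all
within `β` the map `φ⁻¹` contracts; hence such points are unstably equivalent, are determined by
their initial coordinate, and are controlled uniformly by it (`WielerAxioms.exists_forall_dist_lt`).
The second axiom gives the lifting property `WielerAxioms.exists_lift`: a point `w` near the
coordinate `x_{m+K}` yields a point of the local unstable set of `x` whose coordinate `m` is `g^K w`.
Everything follows from these two facts.

* Density: a transit from near `p ∈ P` to a basic open set can be replaced by one that starts on the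
  unstable set of `p` and has the same relevant coordinates.
* `x ∼₀ y` says that the unstable sets of `x` and `y` have the same germ of image in `Y`
  (`simZero_iff`); in this form it is visibly an equivalence relation and invariant under `φ`.
  By lifting, agreement of the coordinates up to `K` implies `x ∼₀ y`.
* The section `s` is continuous because `Y` is a quotient of the compact solenoid, where continuity
  is the lifting property. The remaining identities are formal, and a shift equivalence always
  induces a conjugacy of inverse limits (`IsShiftEquivalence.exists_isConjugacy`).

**Smale spaces.** The space `Ỹ` is a quotient of `X` itself, with the quotient topology. Since the
local stable sets are compact and totally disconnected, they have small clopen pieces, so `X` has a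
finite cover by small rectangles that are invariant under small displacements in the stable
direction. Label a point by the rectangles that its forward orbit visits
(`SmaleSpace.IsSmall.exists_isLabelling`), and relate `z` and `w` if they lie on a common local
stable set and the holonomy `u ↦ [u, w]` preserves labels for `u` near `z`. This relation is an
equivalence relation, invariant under `φ`, contains all sufficiently close stable pairs, and persists
along the holonomy, so that the projection to the quotient is open. If two points on a common local
unstable set are related, then they are equal; applied to the points or to their images under `φ`
this makes the induced map a forward orbit expansive local homeomorphism. Finally
`x ↦ ([x], [φ⁻¹ x], [φ⁻² x], …)` is a conjugacy: related points at time `-n` are exponentially close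
at time `0`.
-/

namespace Wieler

/-! ### Coordinates and the metric of the solenoid -/

section Coordinates

variable {Y : Type*} {g : Y → Y}

theorem iterate_coord (x : InverseLimit g) (k n : ℕ) : g^[k] (x.1 (n + k)) = x.1 n := by
  induction k with
  | zero => rfl
  | succ k ih => rw [Function.iterate_succ_apply, ← add_assoc, x.2, ih]

theorem iterate_coord_of_le (x : InverseLimit g) {m n : ℕ} (h : m ≤ n) :
    g^[n - m] (x.1 n) = x.1 m := by
  have := iterate_coord x (n - m) m
  rwa [Nat.add_sub_cancel' h] at this

theorem shift_iterate_coord (x : InverseLimit g) (k n : ℕ) :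
    ((shift g)^[k] x).1 n = g^[k] (x.1 n) := by
  induction k generalizing x with
  | zero => rfl
  | succ k ih => rw [Function.iterate_succ_apply, ih, Function.iterate_succ_apply]; rfl

theorem shift_symm_iterate_coord (x : InverseLimit g) (k n : ℕ) :
    ((shift g).symm^[k] x).1 n = x.1 (n + k) := by
  induction k generalizing x with
  | zero => rfl
  | succ k ih => rw [Function.iterate_succ_apply, ih]; rfl

theorem shift_iterate_coord_sub (x : InverseLimit g) {k i : ℕ} (h : i ≤ k) :
    ((shift g)^[k] x).1 i = g^[k - i] (x.1 0) := by
  rw [← iterate_coord_of_le _ h, shift_iterate_coord]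
  have := iterate_coord x k 0
  rw [Nat.zero_add] at this
  rw [this]

/-- A point with a compatible sequence of `g ^ K`-preimages lies on a point of the solenoid. -/
theorem exists_inverseLimit_of_iterate {K : ℕ} (hK : 0 < K) (z : ℕ → Y)
    (hz : ∀ j, g^[K] (z (j + 1)) = z j) :
    ∃ y : InverseLimit g, ∀ j, y.1 (j * K) = z j := by
  have hz' : ∀ i j, g^[i * K] (z (j + i)) = z j := by
    intro i
    induction i with
    | zero => intro j; simp
    | succ i ih =>
      intro j
      rw [Nat.succ_mul, Function.iterate_add_apply, ← add_assoc, hz, ih]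
  have hle : ∀ m, m ≤ m * K := fun m => Nat.le_mul_of_pos_right m hK
  refine ⟨⟨fun m => g^[m * K - m] (z m), fun m => ?_⟩, fun j => ?_⟩
  · change g (g^[(m + 1) * K - (m + 1)] (z (m + 1))) = g^[m * K - m] (z m)
    rw [← Function.iterate_succ_apply' g, ← hz m, ← Function.iterate_add_apply]
    have := hle m
    rw [Nat.succ_mul]
    congr 1
    omega
  · change g^[j * K * K - j * K] (z (j * K)) = z j
    rw [← Nat.sub_mul]
    have := hz' (j * K - j) j
    rwa [Nat.add_sub_cancel' (hle j)] at this

end Coordinates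

section Metric

variable {Y : Type*} [MetricSpace Y] {g : Y → Y}

theorem exists_forall_iterate_dist_lt [CompactSpace Y] (hg : Continuous g) (N : ℕ) {ε : ℝ}
    (hε : 0 < ε) :
    ∃ δ > 0, ∀ i ≤ N, ∀ a b : Y, dist a b < δ → dist (g^[i] a) (g^[i] b) < ε := by
  induction N with
  | zero =>
    refine ⟨ε, hε, fun i hi a b h => ?_⟩
    obtain rfl : i = 0 := by omega
    exact h
  | succ N ih =>
    obtain ⟨δ, hδ, h⟩ := ih
    obtain ⟨δ', hδ', h'⟩ := Metric.uniformContinuous_iff.1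
      (CompactSpace.uniformContinuous_of_continuous (hg.iterate (N + 1))) ε hε
    refine ⟨min δ δ', lt_min hδ hδ', fun i hi a b hab => ?_⟩
    rcases Nat.lt_or_ge N i with hi' | hi'
    · obtain rfl : i = N + 1 := by omega
      exact h' (hab.trans_le (min_le_right _ _))
    · exact h i hi' a b (hab.trans_le (min_le_left _ _))

variable {γ : ℝ}

theorem distX'_nonneg (hγ₀ : 0 < γ) (x y : InverseLimit g) : 0 ≤ distX' γ x y :=
  Real.iSup_nonneg fun _ => by positivity

theorem distX_nonneg (hγ₀ : 0 < γ) (K : ℕ) (x y : InverseLimit g) : 0 ≤ distX γ K x y :=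
  Finset.sum_nonneg fun _ _ => mul_nonneg (by positivity) (distX'_nonneg hγ₀ _ _)

theorem distX_self (K : ℕ) (x : InverseLimit g) : distX γ K x x = 0 := by
  simp [distX, distX']

theorem bddAbove_distX' [CompactSpace Y] (hγ₀ : 0 < γ) (hγ₁ : γ < 1) (x y : InverseLimit g) :
    BddAbove (range fun n : ℕ => γ ^ n * dist (x.1 n) (y.1 n)) := by
  refine ⟨Metric.diam (univ : Set Y), ?_⟩
  rintro _ ⟨n, rfl⟩
  have h1 : dist (x.1 n) (y.1 n) ≤ Metric.diam (univ : Set Y) :=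
    Metric.dist_le_diam_of_mem isCompact_univ.isBounded (mem_univ _) (mem_univ _)
  calc γ ^ n * dist (x.1 n) (y.1 n) ≤ 1 * dist (x.1 n) (y.1 n) := by
        gcongr; exact pow_le_one₀ hγ₀.le hγ₁.le
    _ ≤ _ := by rwa [one_mul]

theorem le_distX' [CompactSpace Y] (hγ₀ : 0 < γ) (hγ₁ : γ < 1) (x y : InverseLimit g) (n : ℕ) :
    γ ^ n * dist (x.1 n) (y.1 n) ≤ distX' γ x y :=
  le_ciSup (bddAbove_distX' hγ₀ hγ₁ x y) n

theorem distX'_triangle [CompactSpace Y] (hγ₀ : 0 < γ) (hγ₁ : γ < 1) (x y z : InverseLimit g) :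
    distX' γ x z ≤ distX' γ x y + distX' γ y z :=
  ciSup_le fun n => calc
    γ ^ n * dist (x.1 n) (z.1 n)
        ≤ γ ^ n * (dist (x.1 n) (y.1 n) + dist (y.1 n) (z.1 n)) := by
          gcongr; exact dist_triangle _ _ _
    _ = γ ^ n * dist (x.1 n) (y.1 n) + γ ^ n * dist (y.1 n) (z.1 n) := mul_add _ _ _
    _ ≤ _ := add_le_add (le_distX' hγ₀ hγ₁ x y n) (le_distX' hγ₀ hγ₁ y z n)

theorem distX_triangle [CompactSpace Y] (hγ₀ : 0 < γ) (hγ₁ : γ < 1) (K : ℕ)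
    (x y z : InverseLimit g) : distX γ K x z ≤ distX γ K x y + distX γ K y z := by
  unfold distX
  rw [← Finset.sum_add_distrib]
  refine Finset.sum_le_sum fun i _ => ?_
  rw [← mul_add]
  exact mul_le_mul_of_nonneg_left (distX'_triangle hγ₀ hγ₁ _ _ _) (by positivity)

theorem dist_coord_zero_le_distX [CompactSpace Y] (hγ₀ : 0 < γ) (hγ₁ : γ < 1) (K : ℕ)
    (x y : InverseLimit g) : dist (x.1 0) (y.1 0) ≤ distX γ K x y := by
  have h1 : γ ^ 0 * distX' γ ((shift g)^[0] x) ((shift g)^[0] y) ≤ distX γ K x y :=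
    Finset.single_le_sum
      (f := fun i => γ ^ i * distX' γ ((shift g)^[i] x) ((shift g)^[i] y))
      (fun i _ => mul_nonneg (by positivity) (distX'_nonneg hγ₀ _ _))
      (Finset.mem_range.2 K.succ_pos)
  have h2 := le_distX' hγ₀ hγ₁ x y 0
  simp only [pow_zero, one_mul, Function.iterate_zero, id] at h1 h2
  exact h2.trans h1

theorem distX_le (hγ₀ : 0 < γ) (hγ₁ : γ < 1) (K : ℕ) {x y : InverseLimit g} {ε : ℝ}
    (h : ∀ i ≤ K, ∀ n, dist (g^[i] (x.1 n)) (g^[i] (y.1 n)) ≤ ε) :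
    distX γ K x y ≤ (K + 1) * ε := by
  have hε : 0 ≤ ε := dist_nonneg.trans (h 0 K.zero_le 0)
  have h1 : ∀ i ∈ Finset.range (K + 1),
      γ ^ i * distX' γ ((shift g)^[i] x) ((shift g)^[i] y) ≤ ε := by
    intro i hi
    have h2 : distX' γ ((shift g)^[i] x) ((shift g)^[i] y) ≤ ε := by
      refine ciSup_le fun n => ?_
      rw [shift_iterate_coord, shift_iterate_coord]
      exact (mul_le_of_le_one_left dist_nonneg (pow_le_one₀ hγ₀.le hγ₁.le)).trans
        (h i (Nat.lt_succ_iff.1 (Finset.mem_range.1 hi)) n)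
    exact (mul_le_of_le_one_left (distX'_nonneg hγ₀ _ _) (pow_le_one₀ hγ₀.le hγ₁.le)).trans h2
  refine (Finset.sum_le_sum h1).trans (le_of_eq ?_)
  simp

/-- Uniform closeness of all coordinates implies closeness in `X^u(P)`: the leaf topology is the
topology of uniform convergence of the coordinates. -/
theorem exists_forall_dist_lt_mem_localUnstable [CompactSpace Y] (hg : Continuous g)
    (hγ₀ : 0 < γ) (hγ₁ : γ < 1) (K : ℕ) {ε : ℝ} (hε : 0 < ε) :
    ∃ δ > 0, ∀ x y : InverseLimit g, (∀ n, dist (x.1 n) (y.1 n) < δ) →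
      y ∈ localUnstable γ K x ε := by
  obtain ⟨δ, hδ, h⟩ := exists_forall_iterate_dist_lt hg K
    (ε := ε / (2 * (K + 1))) (by positivity)
  refine ⟨min δ ε, lt_min hδ hε, fun x y hxy => ⟨fun n => (hxy n).trans_le (min_le_right _ _), ?_⟩⟩
  have h1 := distX_le hγ₀ hγ₁ K (x := x) (y := y)
    fun i hi n => (h i hi _ _ ((hxy n).trans_le (min_le_left _ _))).le
  have h2 : ((K : ℝ) + 1) * (ε / (2 * (K + 1))) = ε / 2 := by field_simp
  rw [h2] at h1
  linarith

theorem unstableEquiv_iff [CompactSpace Y] (hg : Continuous g) (hγ₀ : 0 < γ) (hγ₁ : γ < 1) (K : ℕ)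
    (x y : InverseLimit g) :
    UnstableEquiv γ K x y ↔ Tendsto (fun n => dist (x.1 n) (y.1 n)) atTop (𝓝 0) := by
  constructor
  · intro h
    refine squeeze_zero (fun _ => dist_nonneg) (fun n => ?_) h
    have := dist_coord_zero_le_distX hγ₀ hγ₁ K ((shift g).symm^[n] x) ((shift g).symm^[n] y)
    rwa [shift_symm_iterate_coord, shift_symm_iterate_coord, Nat.zero_add] at this
  · intro h
    refine Metric.tendsto_atTop.2 fun ε hε => ?_
    obtain ⟨δ, hδ, hδ'⟩ := exists_forall_dist_lt_mem_localUnstable hg hγ₀ hγ₁ K hε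
    obtain ⟨N, hN⟩ := Metric.tendsto_atTop.1 h δ hδ
    refine ⟨N, fun n hn => ?_⟩
    have h1 := (hδ' ((shift g).symm^[n] x) ((shift g).symm^[n] y) fun m => by
      rw [shift_symm_iterate_coord, shift_symm_iterate_coord]
      have := hN (m + n) (by omega)
      rwa [Real.dist_0_eq_abs, abs_of_nonneg dist_nonneg] at this).2
    rwa [Real.dist_0_eq_abs, abs_of_nonneg (distX_nonneg hγ₀ K _ _)]

end Metric

/-! ### Contraction and lifting in unstable sets -/

section Axioms

variable {Y : Type*} [MetricSpace Y] {g : Y → Y} {β γ : ℝ} {K : ℕ}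

theorem WielerAxioms.dist_le (hW : WielerAxioms g β γ K) {x y : InverseLimit g}
    (h : ∀ n, dist (x.1 n) (y.1 n) ≤ β) (n : ℕ) :
    dist (x.1 n) (y.1 n) ≤ γ ^ K * dist (g^[K] (x.1 n)) (g^[K] (y.1 n)) := by
  have := hW.axiom1 _ _ (h (n + K))
  rwa [two_mul, Function.iterate_add_apply, Function.iterate_add_apply, iterate_coord,
    iterate_coord] at this

/-- Two points of a local unstable set with the same initial coordinate are equal. -/
theorem WielerAxioms.eq_of_coord_zero_eq (hW : WielerAxioms g β γ K) {x y : InverseLimit g}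
    (h : ∀ n, dist (x.1 n) (y.1 n) ≤ β) (h0 : x.1 0 = y.1 0) : x = y := by
  refine Subtype.ext (funext fun n => ?_)
  induction n with
  | zero => exact h0
  | succ n ih =>
    have h1 := hW.dist_le h (n + 1)
    obtain ⟨k, rfl⟩ : ∃ k, K = k + 1 := ⟨K - 1, by have := hW.K_pos; omega⟩
    rw [Function.iterate_succ_apply, Function.iterate_succ_apply, x.2, y.2, ih, dist_self,
      mul_zero] at h1
    exact dist_le_zero.1 h1

/-- On a local unstable set, the initial coordinate controls all coordinates uniformly. -/
theorem WielerAxioms.exists_forall_dist_lt [CompactSpace Y] (hW : WielerAxioms g β γ K) {ε : ℝ}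
    (hε : 0 < ε) :
    ∃ η > 0, ∀ x y : InverseLimit g, (∀ n, dist (x.1 n) (y.1 n) ≤ β) →
      dist (x.1 0) (y.1 0) < η → ∀ n, dist (x.1 n) (y.1 n) < ε := by
  obtain ⟨η, hη, h⟩ := exists_forall_iterate_dist_lt hW.continuous K hε
  refine ⟨η, hη, fun x y hxy h0 n => ?_⟩
  induction n using Nat.strong_induction_on with
  | _ n ih =>
    rcases Nat.eq_zero_or_pos n with rfl | hn
    · exact h 0 K.zero_le _ _ h0
    have h1 : dist (g^[K] (x.1 n)) (g^[K] (y.1 n)) < ε := by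
      rcases Nat.lt_or_ge n K with hnK | hnK
      · have h2 : ∀ z : InverseLimit g, g^[K] (z.1 n) = g^[K - n] (z.1 0) := fun z => by
          rw [← iterate_coord_of_le z n.zero_le, ← Function.iterate_add_apply]
          congr 2
          omega
        rw [h2, h2]
        exact h _ (by omega) _ _ h0
      · have h2 : ∀ z : InverseLimit g, g^[K] (z.1 n) = z.1 (n - K) := fun z => by
          have := iterate_coord z K (n - K)
          rwa [Nat.sub_add_cancel hnK] at this
        rw [h2, h2]
        exact ih _ (by have := hW.K_pos; omega)
    refine (hW.dist_le hxy n).trans_lt (lt_of_le_of_lt ?_ h1)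
    exact mul_le_of_le_one_left dist_nonneg (pow_le_one₀ hW.γ_pos.le hW.γ_lt_one.le)

theorem WielerAxioms.tendsto_dist (hW : WielerAxioms g β γ K) {x y : InverseLimit g}
    (h : ∀ n, dist (x.1 n) (y.1 n) ≤ β) :
    Tendsto (fun n => dist (x.1 n) (y.1 n)) atTop (𝓝 0) := by
  have hK := hW.K_pos
  have h1 : ∀ n, dist (x.1 n) (y.1 n) ≤ (γ ^ K) ^ (n / K) * β := by
    intro n
    induction n using Nat.strong_induction_on with
    | _ n ih =>
      rcases Nat.lt_or_ge n K with hnK | hnK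
      · simpa [Nat.div_eq_of_lt hnK] using h n
      · obtain ⟨m, rfl⟩ : ∃ m, n = m + K := ⟨n - K, by omega⟩
        have h2 := hW.dist_le h (m + K)
        rw [iterate_coord, iterate_coord] at h2
        rw [Nat.add_div_right _ hK, pow_succ', mul_assoc]
        exact h2.trans (mul_le_mul_of_nonneg_left (ih m (by omega)) (pow_pos hW.γ_pos K).le)
  have h2 : Tendsto (fun n => (γ ^ K) ^ (n / K) * β) atTop (𝓝 (0 * β)) :=
    ((tendsto_pow_atTop_nhds_zero_of_lt_one (pow_pos hW.γ_pos K).le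
      (pow_lt_one₀ hW.γ_pos.le hW.γ_lt_one hK.ne')).comp
        (Nat.tendsto_div_const_atTop hK.ne')).mul_const β
  rw [zero_mul] at h2
  exact squeeze_zero (fun _ => dist_nonneg) h1 h2

theorem WielerAxioms.exists_lift_zero [CompactSpace Y] (hW : WielerAxioms g β γ K) {ε : ℝ}
    (hε : 0 < ε) :
    ∃ δ > 0, ∀ (x : InverseLimit g) (w : Y), dist w (x.1 K) < δ →
      ∃ y : InverseLimit g, y.1 0 = g^[K] w ∧ ∀ n, dist (x.1 n) (y.1 n) < ε := by
  obtain ⟨δ₀, hδ₀, hδ⟩ := exists_forall_iterate_dist_lt hW.continuous (2 * K) hε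
  refine ⟨min δ₀ β, lt_min hδ₀ hW.β_pos, fun x w hw => ?_⟩
  set δ := min δ₀ β
  have hδpos : 0 < δ := lt_min hδ₀ hW.β_pos
  -- Iterating the second axiom gives a sequence `w j` near the coordinates of `x` whose images
  -- under `g ^ K` are successive `g ^ K`-preimages.
  have hstep : ∀ (j : ℕ) (v : Y), ∃ v' : Y, dist v (x.1 ((j + 1) * K)) < δ →
      dist v' (x.1 ((j + 2) * K)) < δ ∧ g^[2 * K] v' = g^[K] v := by
    intro j v
    by_cases hv : dist v (x.1 ((j + 1) * K)) < δ
    · have h1 : g^[K] (x.1 ((j + 2) * K)) = x.1 ((j + 1) * K) := by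
        have := iterate_coord x K ((j + 1) * K)
        rwa [← Nat.succ_mul] at this
      obtain ⟨v', hv', h2⟩ := hW.axiom2 (x.1 ((j + 2) * K)) δ hδpos (min_le_right _ _)
        (mem_image_of_mem _ (by rw [h1]; exact hv))
      exact ⟨v', fun _ => ⟨(Metric.mem_ball.1 hv').trans_le
        (mul_le_of_le_one_left hδpos.le hW.γ_lt_one.le), h2⟩⟩
    · exact ⟨v, fun h => absurd h hv⟩
  choose F hF using hstep
  let ws : ℕ → Y := fun j => Nat.rec w F j
  have hws : ∀ j, dist (ws j) (x.1 ((j + 1) * K)) < δ := by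
    intro j
    induction j with
    | zero => simpa [ws] using hw
    | succ j ih => exact (hF j _ ih).1
  obtain ⟨y, hy⟩ := exists_inverseLimit_of_iterate hW.K_pos (fun j => g^[K] (ws j)) fun j => by
    rw [← Function.iterate_add_apply, ← two_mul]
    exact (hF j _ (hws j)).2
  refine ⟨y, ?_, fun n => ?_⟩
  · simpa [ws] using hy 0
  · have hn : n ≤ (n / K + 1) * K := by
      rw [Nat.succ_mul]
      have := Nat.div_add_mod' n K
      have := Nat.mod_lt n hW.K_pos
      omega
    have hn' : (n / K + 1) * K - n ≤ K := by
      rw [Nat.succ_mul]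
      have := Nat.div_add_mod' n K
      omega
    rw [← iterate_coord_of_le y hn, hy, ← iterate_coord_of_le x hn,
      ← iterate_coord x K ((n / K + 1) * K), ← Nat.succ_mul, ← Function.iterate_add_apply,
      ← Function.iterate_add_apply, dist_comm]
    exact hδ _ (by omega) _ _ ((hws (n / K + 1)).trans_le (min_le_left _ _))

theorem exists_shift_dist_lt [CompactSpace Y] (hg : Continuous g) {ε : ℝ} (hε : 0 < ε) :
    ∃ δ > 0, ∀ x y : InverseLimit g, (∀ n, dist (x.1 n) (y.1 n) < δ) →
      ∀ n, dist ((shift g x).1 n) ((shift g y).1 n) < ε := by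
  obtain ⟨δ, hδ, h⟩ := exists_forall_iterate_dist_lt hg 1 hε
  exact ⟨δ, hδ, fun x y hxy n => h 1 le_rfl _ _ (hxy n)⟩

/-- The half of the local product structure that is used here: given a point `w` close to the
coordinate `x_{m+K}`, there is a point of the solenoid through `g ^ K w` at the coordinate `m`,
uniformly close to `x`, hence on the local unstable set of `x`. -/
theorem WielerAxioms.exists_lift [CompactSpace Y] (hW : WielerAxioms g β γ K) (m : ℕ) {ε : ℝ}
    (hε : 0 < ε) :
    ∃ δ > 0, ∀ (x : InverseLimit g) (w : Y), dist w (x.1 (m + K)) < δ →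
      ∃ y : InverseLimit g, y.1 m = g^[K] w ∧ ∀ n, dist (x.1 n) (y.1 n) < ε := by
  induction m generalizing ε with
  | zero => simpa using hW.exists_lift_zero hε
  | succ m ih =>
    obtain ⟨ε', hε', h⟩ := exists_shift_dist_lt hW.continuous hε
    obtain ⟨δ, hδ, hl⟩ := ih hε'
    refine ⟨δ, hδ, fun x w hw => ?_⟩
    obtain ⟨y, hy, hxy⟩ := hl ((shift g).symm x) w (by
      change dist w (x.1 (m + K + 1)) < δ
      rwa [Nat.add_right_comm])
    refine ⟨shift g y, (y.2 m).trans hy, fun n => ?_⟩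
    · have := h _ _ hxy n
      rwa [Equiv.apply_symm_apply] at this

end Axioms

/-! ### The topology of `X^u(P)` -/

section UnstableTopology

variable {Y : Type*} [MetricSpace Y] [CompactSpace Y] {g : Y → Y} {β γ : ℝ} {K : ℕ}
  {P : Set (InverseLimit g)}

theorem WielerAxioms.isOpen_localUnstable (hW : WielerAxioms g β γ K) (x : InverseLimit g) {ε : ℝ}
    (hε : 0 < ε) (hεβ : ε ≤ β) :
    IsOpen {u : XuP γ K P | u.val ∈ localUnstable γ K x ε} := by
  intro u hu
  -- The distances `dist (x n) (u n)` tend to zero, so their supremum is attained and is `< ε`.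
  obtain ⟨η, hη, hηu⟩ : ∃ η > 0, ∀ n, dist (x.1 n) (u.val.1 n) + η ≤ ε := by
    have h0 := hW.tendsto_dist fun n => (hu.1 n).le.trans hεβ
    obtain ⟨N, hN⟩ := Metric.tendsto_atTop.1 h0 (ε / 2) (half_pos hε)
    have hN' : ∀ N : ℕ, ∃ η > 0, ∀ n < N, dist (x.1 n) (u.val.1 n) + η ≤ ε := by
      intro N
      induction N with
      | zero => exact ⟨1, one_pos, fun n hn => absurd hn n.not_lt_zero⟩
      | succ N ih =>
        obtain ⟨η, hη, h⟩ := ih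
        refine ⟨min η (ε - dist (x.1 N) (u.val.1 N)), lt_min hη (sub_pos.2 (hu.1 N)),
          fun n hn => ?_⟩
        rcases Nat.lt_succ_iff_lt_or_eq.1 hn with hn | rfl
        · exact (add_le_add le_rfl (min_le_left _ _)).trans (h n hn)
        · linarith [min_le_right η (ε - dist (x.1 n) (u.val.1 n))]
    obtain ⟨η, hη, h⟩ := hN' N
    refine ⟨min η (ε / 2), lt_min hη (half_pos hε), fun n => ?_⟩
    rcases Nat.lt_or_ge n N with hn | hn
    · exact (add_le_add le_rfl (min_le_left _ _)).trans (h n hn)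
    · have := hN n hn
      rw [Real.dist_0_eq_abs, abs_of_nonneg dist_nonneg] at this
      linarith [min_le_right η (ε / 2)]
  refine ⟨min η (ε - distX γ K x u.val), lt_min hη (sub_pos.2 hu.2), fun v hv => ⟨fun n => ?_, ?_⟩⟩
  · have h1 := (hv.1 n).trans_le (min_le_left _ _)
    linarith [dist_triangle (x.1 n) (u.val.1 n) (v.val.1 n), hηu n]
  · have h1 := hv.2.trans_le (min_le_right _ _)
    linarith [distX_triangle hW.γ_pos hW.γ_lt_one K x u.val v.val]

theorem WielerAxioms.exists_mem_localUnstable (hW : WielerAxioms g β γ K) {ε : ℝ} (hε : 0 < ε) :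
    ∃ δ > 0, ∀ x y : InverseLimit g, (∀ n, dist (x.1 n) (y.1 n) < δ) →
      y ∈ localUnstable γ K x ε :=
  exists_forall_dist_lt_mem_localUnstable hW.continuous hW.γ_pos hW.γ_lt_one K hε

omit [CompactSpace Y] in
theorem mem_localUnstable_self (x : InverseLimit g) {ε : ℝ} (hε : 0 < ε) :
    x ∈ localUnstable γ K x ε :=
  ⟨fun n => by rwa [dist_self], by rwa [distX_self]⟩

/-- The topology of `X^u(P)` is that of uniform convergence of the coordinates. -/
theorem WielerAxioms.mem_nhds_iff (hW : WielerAxioms g β γ K) {x : XuP γ K P}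
    {s : Set (XuP γ K P)} :
    s ∈ 𝓝 x ↔ ∃ δ > 0, ∀ u : XuP γ K P, (∀ n, dist (x.val.1 n) (u.val.1 n) < δ) → u ∈ s := by
  constructor
  · intro h
    obtain ⟨t, hts, ht, hxt⟩ := _root_.mem_nhds_iff.1 h
    obtain ⟨δ, hδ, h1⟩ := ht x hxt
    obtain ⟨δ', hδ', h2⟩ := hW.exists_mem_localUnstable hδ
    exact ⟨δ', hδ', fun u hu => hts (h1 u (h2 _ _ hu))⟩
  · rintro ⟨δ, hδ, h⟩
    have h0 : 0 < min δ β := lt_min hδ hW.β_pos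
    refine mem_of_superset ((hW.isOpen_localUnstable x.val h0 (min_le_right _ _)).mem_nhds
      (mem_localUnstable_self _ h0)) fun u hu => h u fun n => (hu.1 n).trans_le (min_le_left _ _)

theorem WielerAxioms.localUnstable_mem_nhds (hW : WielerAxioms g β γ K) (x : XuP γ K P) {ε : ℝ}
    (hε : 0 < ε) : {u : XuP γ K P | u.val ∈ localUnstable γ K x.val ε} ∈ 𝓝 x := by
  obtain ⟨δ, hδ, h⟩ := hW.exists_mem_localUnstable hε
  exact hW.mem_nhds_iff.2 ⟨δ, hδ, fun u hu => h _ _ hu⟩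

/-- On a local unstable set, closeness of the initial coordinate implies closeness in `X^u(P)`. -/
theorem WielerAxioms.exists_mem_of_coord_zero (hW : WielerAxioms g β γ K) {x : XuP γ K P}
    {s : Set (XuP γ K P)} (hs : s ∈ 𝓝 x) :
    ∃ η > 0, ∀ u : XuP γ K P, (∀ n, dist (x.val.1 n) (u.val.1 n) ≤ β) →
      dist (pi0 x) (pi0 u) < η → u ∈ s := by
  obtain ⟨δ, hδ, h⟩ := hW.mem_nhds_iff.1 hs
  obtain ⟨η, hη, h'⟩ := hW.exists_forall_dist_lt hδ
  exact ⟨η, hη, fun u hu h0 => h u (h' _ _ hu h0)⟩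

theorem WielerAxioms.continuous_pi0 (hW : WielerAxioms g β γ K) :
    Continuous (pi0 : XuP γ K P → Y) := by
  refine continuous_iff_continuousAt.2 fun x => Metric.tendsto_nhds.2 fun ε hε => ?_
  exact hW.mem_nhds_iff.2 ⟨ε, hε, fun u hu => by
    rw [mem_ofPred_eq, dist_comm]
    exact hu 0⟩

theorem WielerAxioms.mem_unstableSet_of_dist_le (hW : WielerAxioms g β γ K) {x y : InverseLimit g}
    (hx : x ∈ unstableSet γ K P) (h : ∀ n, dist (x.1 n) (y.1 n) ≤ β) :
    y ∈ unstableSet γ K P := by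
  obtain ⟨p, hp, hxp⟩ := hx
  refine ⟨p, hp, ?_⟩
  rw [unstableEquiv_iff hW.continuous hW.γ_pos hW.γ_lt_one] at hxp ⊢
  have h1 := (hW.tendsto_dist h).add hxp
  rw [add_zero] at h1
  refine squeeze_zero (fun _ => dist_nonneg) (fun n => ?_) h1
  rw [dist_comm (x.1 n)]
  exact dist_triangle _ _ _

theorem WielerAxioms.shift_symm_mem_unstableSet (hW : WielerAxioms g β γ K)
    (hP : shift g '' P = P) {x : InverseLimit g} (hx : x ∈ unstableSet γ K P) :
    (shift g).symm x ∈ unstableSet γ K P := by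
  obtain ⟨p, hp, hxp⟩ := hx
  rw [← hP] at hp
  obtain ⟨q, hq, rfl⟩ := hp
  refine ⟨q, hq, ?_⟩
  rw [unstableEquiv_iff hW.continuous hW.γ_pos hW.γ_lt_one] at hxp ⊢
  have h1 := (tendsto_add_atTop_iff_nat 1).2 hxp
  refine h1.congr fun n => ?_
  have : (shift g q).1 (n + 1) = q.1 n := q.2 n
  rw [this]
  rfl

/-- The homeomorphism of `X^u(P)` that `φ` induces. -/
def shiftHomeo (hW : WielerAxioms g β γ K) (hP : shift g '' P = P) : XuP γ K P ≃ₜ XuP γ K P where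
  toFun := shiftU hP
  invFun x := ⟨(shift g).symm x.val, hW.shift_symm_mem_unstableSet hP x.mem⟩
  left_inv x := by
    cases x
    simp [shiftU]
  right_inv x := by
    cases x
    simp [shiftU]
  continuous_toFun := by
    refine continuous_iff_continuousAt.2 fun x s hs => ?_
    obtain ⟨ε, hε, h⟩ := hW.mem_nhds_iff.1 hs
    obtain ⟨δ, hδ, h'⟩ := exists_shift_dist_lt hW.continuous hε
    exact hW.mem_nhds_iff.2 ⟨δ, hδ, fun u hu => h _ (h' _ _ hu)⟩
  continuous_invFun := by
    refine continuous_iff_continuousAt.2 fun x s hs => ?_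
    obtain ⟨ε, hε, h⟩ := hW.mem_nhds_iff.1 hs
    exact hW.mem_nhds_iff.2 ⟨ε, hε, fun u hu => h _ fun n => hu (n + 1)⟩

end UnstableTopology

/-! ### The relation `∼₀` as an equality of germs -/

section SimZero

variable {Y : Type*} [MetricSpace Y] [CompactSpace Y] {g : Y → Y} {β γ : ℝ} {K : ℕ}
  {P : Set (InverseLimit g)} {εY : ℝ}

/-- The germ at `x₀` of the image of the unstable set of `x` in `Y` is contained in the image of
the local unstable set of `y`. -/
def GermLE (εY : ℝ) (x y : XuP γ K P) : Prop :=
  ∀ᶠ u in 𝓝 x, ∃ v : XuP γ K P, v.val ∈ localUnstable γ K y.val εY ∧ pi0 v = pi0 u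

/-- In the definition of `GermLE` the points `v` may be taken in any neighbourhood of `y`. -/
theorem GermLE.eventually_exists_mem (hW : WielerAxioms g β γ K) (hεβ : εY ≤ β / 2)
    {x y : XuP γ K P} (h : GermLE εY x y) (h0 : pi0 x = pi0 y) {s : Set (XuP γ K P)}
    (hs : s ∈ 𝓝 y) :
    ∀ᶠ u in 𝓝 x, ∃ v ∈ s, v.val ∈ localUnstable γ K y.val εY ∧ pi0 v = pi0 u := by
  obtain ⟨η, hη, hηs⟩ := hW.exists_mem_of_coord_zero hs
  have h1 : ∀ᶠ u in 𝓝 x, dist (pi0 u) (pi0 x) < η :=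
    Metric.tendsto_nhds.1 (hW.continuous_pi0.tendsto x) η hη
  filter_upwards [h, h1] with u hu hux
  obtain ⟨v, hv, hvu⟩ := hu
  refine ⟨v, hηs v (fun n => ?_) ?_, hv, hvu⟩
  · linarith [hv.1 n, hW.β_pos]
  · rwa [hvu, ← h0, dist_comm]

theorem GermLE.refl (hW : WielerAxioms g β γ K) (hε : 0 < εY) (x : XuP γ K P) : GermLE εY x x := by
  filter_upwards [hW.localUnstable_mem_nhds x hε] with u hu
  exact ⟨u, hu, rfl⟩

theorem GermLE.trans (hW : WielerAxioms g β γ K) (hεβ : εY ≤ β / 2)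
    {x y z : XuP γ K P} (h : GermLE εY x y) (h0 : pi0 x = pi0 y) (h' : GermLE εY y z) :
    GermLE εY x z := by
  filter_upwards [h.eventually_exists_mem hW hεβ h0 h'] with u ⟨v, hv, _, hvu⟩
  obtain ⟨w, hw, hwv⟩ := hv
  exact ⟨w, hw, hwv.trans hvu⟩

theorem GermLE.shiftU (hW : WielerAxioms g β γ K) (hε : 0 < εY) (hεβ : εY ≤ β / 2)
    (hP : shift g '' P = P) {x y : XuP γ K P} (h : GermLE εY x y) (h0 : pi0 x = pi0 y) :
    GermLE εY (shiftU hP x) (shiftU hP y) := by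
  have h1 := (shiftHomeo hW hP).continuous.continuousAt.preimage_mem_nhds
    (hW.localUnstable_mem_nhds (shiftHomeo hW hP y) hε)
  have h2 : Tendsto (shiftHomeo hW hP).symm (𝓝 (Wieler.shiftU hP x)) (𝓝 x) := by
    have := (shiftHomeo hW hP).symm.continuous.tendsto (shiftHomeo hW hP x)
    rwa [Homeomorph.symm_apply_apply] at this
  filter_upwards [h2.eventually (h.eventually_exists_mem hW hεβ h0 h1)] with u ⟨v, hv, _, hvu⟩
  refine ⟨Wieler.shiftU hP v, hv, ?_⟩
  have h3 : g (pi0 v) = g (u.val.1 1) := congrArg g hvu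
  exact h3.trans (u.val.2 0)

/-- `x ∼₀ y` holds when `x` and `y` have the same initial coordinate and the unstable sets of `x`
and `y` have the same image in `Y` near that point. -/
theorem simZero_iff (hW : WielerAxioms g β γ K) (hε : 0 < εY) (hεβ : εY ≤ β / 2)
    {x y : XuP γ K P} :
    SimZero εY x y ↔ pi0 x = pi0 y ∧ GermLE εY x y ∧ GermLE εY y x := by
  have hβ := hW.β_pos
  have hsmall : ∀ {a b c : InverseLimit g}, b ∈ localUnstable γ K a εY →
      c ∈ localUnstable γ K a εY → ∀ n, dist (b.1 n) (c.1 n) ≤ β := by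
    intro a b c hb hc n
    linarith [dist_triangle_left (b.1 n) (c.1 n) (a.1 n), hb.1 n, hc.1 n]
  constructor
  · rintro ⟨h0, δ, hδ, hδε, U, hU, hUy, himg⟩
    refine ⟨h0, ?_, ?_⟩
    · filter_upwards [hW.localUnstable_mem_nhds x hδ] with u hu
      obtain ⟨v, hv, hvu⟩ := himg.subset (mem_image_of_mem _ hu)
      exact ⟨v, hUy v hv, hvu⟩
    · have hyU : y ∈ U := by
        obtain ⟨v, hv, hvx⟩ := himg.subset (mem_image_of_mem _ (mem_localUnstable_self _ hδ))
        have : v.val = y.val := hW.eq_of_coord_zero_eq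
          (hsmall (hUy v hv) (mem_localUnstable_self _ hε)) (hvx.trans h0)
        cases v
        cases y
        cases this
        exact hv
      filter_upwards [hU.mem_nhds hyU] with v hv
      obtain ⟨u, hu, huv⟩ := himg.symm.subset (mem_image_of_mem _ hv)
      exact ⟨u, ⟨fun n => (hu.1 n).trans hδε, hu.2.trans hδε⟩, huv⟩
  · rintro ⟨h0, hxy, hyx⟩
    -- `U` consists of the points of `X^u(y, εY)` that lie over `X^u(x, δ)`; it is open since its
    -- points are interior to the set where the germ condition for `(y, x)` holds.
    have h1 := hxy.eventually_exists_mem hW hεβ h0 (eventually_mem_nhds_iff.2 hyx)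
    obtain ⟨δ', hδ', h2⟩ := hW.mem_nhds_iff.1 h1
    obtain ⟨δ, hδ, hδε, hδδ⟩ : ∃ δ > 0, δ < εY ∧ δ ≤ δ' :=
      ⟨min (εY / 2) δ', lt_min (half_pos hε) hδ', (min_le_left _ _).trans_lt (half_lt_self hε),
        min_le_right _ _⟩
    have hover : ∀ u : XuP γ K P, u.val ∈ localUnstable γ K x.val δ →
        ∃ v : XuP γ K P, v.val ∈ localUnstable γ K y.val εY ∧ pi0 v = pi0 u ∧
          {v | ∃ u : XuP γ K P, u.val ∈ localUnstable γ K x.val εY ∧ pi0 u = pi0 v} ∈ 𝓝 v := by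
      intro u hu
      obtain ⟨v, hv, hvy, hvu⟩ := h2 u fun n => (hu.1 n).trans_le hδδ
      exact ⟨v, hvy, hvu, hv⟩
    refine ⟨h0, δ, hδ, hδε, {v | v.val ∈ localUnstable γ K y.val εY ∧
      ∃ u : XuP γ K P, u.val ∈ localUnstable γ K x.val δ ∧ pi0 u = pi0 v}, ?_,
      fun v hv => hv.1, ?_⟩
    · refine isOpen_iff_mem_nhds.2 fun v hv => ?_
      obtain ⟨hvy, u, hu, huv⟩ := hv
      obtain ⟨v', hv'y, hv'u, hv'⟩ := hover u hu
      have hvv' : v'.val = v.val := hW.eq_of_coord_zero_eq (hsmall hv'y hvy) (hv'u.trans huv)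
      obtain rfl : v' = v := by
        cases v
        cases v'
        cases hvv'
        rfl
      obtain ⟨η, hη, hηu⟩ := hW.exists_mem_of_coord_zero
        ((hW.isOpen_localUnstable (P := P) x.val hδ (by linarith)).mem_nhds hu)
      have h3 := Metric.tendsto_nhds.1 ((hW.continuous_pi0 (P := P)).tendsto v') η hη
      filter_upwards [hv', h3, (hW.isOpen_localUnstable (P := P) y.val hε (by linarith)).mem_nhds
        hvy] with w ⟨u', hu', hu'w⟩ hwv hwy
      refine ⟨hwy, u', hηu u' ?_ ?_, hu'w⟩
      · exact hsmall ⟨fun n => (hu.1 n).trans hδε, hu.2.trans hδε⟩ hu'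
      · rwa [huv, hu'w, dist_comm]
    · ext a
      constructor
      · rintro ⟨u, hu, rfl⟩
        obtain ⟨v, hvy, hvu, -⟩ := hover u hu
        exact ⟨v, ⟨hvy, u, hu, hvu.symm⟩, hvu⟩
      · rintro ⟨v, ⟨-, u, hu, huv⟩, rfl⟩
        exact ⟨u, hu, huv⟩

theorem simZero_equivalence (hW : WielerAxioms g β γ K) (hε : 0 < εY) (hεβ : εY ≤ β / 2) :
    Equivalence (SimZero (γ := γ) (K := K) (P := P) εY) where
  refl x := (simZero_iff hW hε hεβ).2 ⟨rfl, GermLE.refl hW hε x, GermLE.refl hW hε x⟩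
  symm h := by
    rw [simZero_iff hW hε hεβ] at h ⊢
    exact ⟨h.1.symm, h.2.2, h.2.1⟩
  trans h h' := by
    rw [simZero_iff hW hε hεβ] at h h' ⊢
    exact ⟨h.1.trans h'.1, h.2.1.trans hW hεβ h.1 h'.2.1,
      h'.2.2.trans hW hεβ h'.1.symm h.2.2⟩

theorem SimZero.shiftU (hW : WielerAxioms g β γ K) (hε : 0 < εY) (hεβ : εY ≤ β / 2)
    (hP : shift g '' P = P) {x y : XuP γ K P} (h : SimZero εY x y) :
    SimZero εY (shiftU hP x) (shiftU hP y) := by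
  rw [simZero_iff hW hε hεβ] at h ⊢
  exact ⟨congrArg g h.1, h.2.1.shiftU hW hε hεβ hP h.1, h.2.2.shiftU hW hε hεβ hP h.1.symm⟩

/-- If `y` agrees with `x` up to coordinate `K`, then every point near `x` lifts to the local
unstable set of `y`. -/
theorem WielerAxioms.germLE_of_coord_eq (hW : WielerAxioms g β γ K) (hε : 0 < εY)
    {x y : XuP γ K P} (h : x.val.1 K = y.val.1 K) : GermLE εY x y := by
  obtain ⟨ε, hε0, hεu⟩ := hW.exists_mem_localUnstable hε
  obtain ⟨δ, hδ, hl⟩ := hW.exists_lift 0 (lt_min hε0 hW.β_pos)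
  refine hW.mem_nhds_iff.2 ⟨δ, hδ, fun u hu => ?_⟩
  obtain ⟨v, hv, hyv⟩ := hl y.val (u.val.1 K) (by
    rw [Nat.zero_add, ← h, dist_comm]
    exact hu K)
  refine ⟨⟨v, hW.mem_unstableSet_of_dist_le y.mem fun n =>
    ((hyv n).trans_le (min_le_right _ _)).le⟩,
    hεu _ _ fun n => (hyv n).trans_le (min_le_left _ _), hv.trans ?_⟩
  have := iterate_coord u.val K 0
  rwa [Nat.zero_add] at this

theorem WielerAxioms.simZero_of_coord_eq (hW : WielerAxioms g β γ K) (hε : 0 < εY)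
    (hεβ : εY ≤ β / 2) {x y : XuP γ K P} (h : ∀ i ≤ K, x.val.1 i = y.val.1 i) :
    SimZero εY x y :=
  (simZero_iff hW hε hεβ).2 ⟨h 0 K.zero_le, hW.germLE_of_coord_eq hε (h K le_rfl),
    hW.germLE_of_coord_eq hε (h K le_rfl).symm⟩

end SimZero

/-! ### Density of `X^u(P)` -/

section Density

variable {Y : Type*} [MetricSpace Y] [CompactSpace Y] {g : Y → Y} {β γ : ℝ} {K : ℕ}
  {P : Set (InverseLimit g)}

/-- A transit from near `p ∈ P` to a basic open set can be moved, without changing the relevant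
coordinates, to a transit that starts on the unstable set of `p`. -/
theorem WielerAxioms.dense_unstableSet (hW : WielerAxioms g β γ K) (hP : shift g '' P = P)
    (hirr : IsIrreducibleSystem (shift g)) (hne : P.Nonempty) : Dense (unstableSet γ K P) := by
  obtain ⟨p, hp⟩ := hne
  refine dense_iff_inter_open.2 fun V hV ⟨v, hv⟩ => ?_
  -- `V` contains all points with the same first coordinates as one of its points `a`.
  obtain ⟨W, hW', rfl⟩ := isOpen_induced_iff.1 hV
  obtain ⟨I, u, hu, huW⟩ := isOpen_pi_iff.1 hW' v.1 hv
  obtain ⟨m, hm⟩ : ∃ m, ∀ i ∈ I, i ≤ m := ⟨I.sup id, fun i hi => Finset.le_sup (f := id) hi⟩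
  obtain ⟨δ, hδ, hl⟩ := hW.exists_lift m hW.β_pos
  have hUopen : IsOpen {x : InverseLimit g | dist (x.1 (m + K)) (p.1 (m + K)) < δ} :=
    isOpen_lt (((continuous_apply (m + K)).comp continuous_subtype_val).dist continuous_const)
      continuous_const
  have hV' : IsOpen ((Subtype.val : InverseLimit g → ℕ → Y) ⁻¹' ((I : Set ℕ).pi u)) :=
    (isOpen_set_pi I.finite_toSet fun i hi => (hu i hi).1).preimage continuous_subtype_val
  obtain ⟨n, -, _, ⟨a, ha, rfl⟩, haV⟩ := hirr _ _ hUopen hV' ⟨p, by simpa using hδ⟩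
    ⟨v, fun i hi => (hu i hi).2⟩
  obtain ⟨y, hy, hpy⟩ := hl p (a.1 (m + K)) ha
  have hya : ∀ i ≤ m, y.1 i = a.1 i := by
    intro i hi
    rw [← iterate_coord_of_le y hi, ← iterate_coord_of_le a hi, hy, iterate_coord]
  refine ⟨(shift g)^[n] y, huW fun i hi => ?_, ?_⟩
  · rw [shift_iterate_coord, hya i (hm i hi), ← shift_iterate_coord]
    exact haV i hi
  · have hyu : y ∈ unstableSet γ K P := hW.mem_unstableSet_of_dist_le (P := P)
      ⟨p, hp, by simp [UnstableEquiv, distX_self]⟩ fun n => (hpy n).le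
    have : ∀ n, (shift g)^[n] y ∈ unstableSet γ K P := by
      intro n
      induction n with
      | zero => exact hyu
      | succ n ih =>
        rw [Function.iterate_succ_apply']
        exact (shiftU hP ⟨_, ih⟩).mem
    exact this n

/-- If `X^u(P)` is dense, then every point agrees with a point of `X^u(P)` in any prescribed
finite number of coordinates. -/
theorem WielerAxioms.exists_coord_eq (hW : WielerAxioms g β γ K)
    (hd : Dense (unstableSet γ K P)) (x : InverseLimit g) (m : ℕ) :
    ∃ z : XuP γ K P, ∀ i ≤ m, z.val.1 i = x.1 i := by
  obtain ⟨δ, hδ, hl⟩ := hW.exists_lift m hW.β_pos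
  have hUopen : IsOpen {z : InverseLimit g | dist (x.1 (m + K)) (z.1 (m + K)) < δ} :=
    isOpen_lt (continuous_const.dist ((continuous_apply (m + K)).comp continuous_subtype_val))
      continuous_const
  obtain ⟨a, ha, hau⟩ := hd.inter_open_nonempty _ hUopen ⟨x, by simpa using hδ⟩
  obtain ⟨y, hy, hay⟩ := hl a (x.1 (m + K)) ha
  refine ⟨⟨y, hW.mem_unstableSet_of_dist_le hau fun n => (hay n).le⟩, fun i hi => ?_⟩
  change y.1 i = x.1 i
  rw [← iterate_coord_of_le y hi, ← iterate_coord_of_le x hi, hy, iterate_coord]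

theorem exists_coord_zero_eq {Y : Type*} {g : Y → Y} (hg : Function.Surjective g) (y : Y) :
    ∃ x : InverseLimit g, x.1 0 = y := by
  obtain ⟨h, hh⟩ := hg.hasRightInverse
  exact ⟨⟨fun n => h^[n] y, fun i => by
    simp only [Function.iterate_succ_apply', hh _]⟩, rfl⟩

end Density

/-! ### The shift equivalence -/

section ShiftEquivalence

theorem isClosed_inverseLimit {Y : Type*} [TopologicalSpace Y] [T2Space Y] {g : Y → Y}
    (hg : Continuous g) : IsClosed {x : ℕ → Y | ∀ i, g (x (i + 1)) = x i} := by
  simp only [ofPred_forall]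
  exact isClosed_iInter fun i =>
    isClosed_eq (hg.comp (continuous_apply (i + 1))) (continuous_apply i)

theorem isQuotientMap_coord_zero {Y : Type*} [TopologicalSpace Y] [T2Space Y] [CompactSpace Y]
    {g : Y → Y} (hg : Continuous g) (hs : Function.Surjective g) :
    IsQuotientMap fun x : InverseLimit g => x.1 0 := by
  have : CompactSpace (InverseLimit g) :=
    isCompact_iff_compactSpace.1 (isClosed_inverseLimit hg).isCompact
  have hc : Continuous fun x : InverseLimit g => x.1 0 :=
    (continuous_apply 0).comp continuous_subtype_val
  exact hc.isClosedMap.isQuotientMap hc (exists_coord_zero_eq hs)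

/-- A shift equivalence induces a conjugacy of the inverse limits, with inverse
`(q_n)_n ↦ (r (q_{n + L}))_n`. -/
theorem IsShiftEquivalence.exists_isConjugacy {A B : Type*} [TopologicalSpace A]
    [TopologicalSpace B] {f : A → A} {h : B → B} {r : A → B} {s : B → A} {L : ℕ}
    (H : IsShiftEquivalence f h r s L) :
    ∃ S : InverseLimit h → InverseLimit f, (∀ x n, (S x).1 n = s (x.1 n)) ∧
      IsConjugacy (shift h) (shift f) S := by
  have hs : ∀ b, f (s b) = s (h b) := fun b => (congrFun H.s_comp b).symm
  have hr : ∀ a, h (r a) = r (f a) := fun a => (congrFun H.r_comp a).symm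
  let S : InverseLimit h ≃ₜ InverseLimit f :=
    { toFun := fun x => ⟨fun n => s (x.1 n), fun i => by rw [hs, x.2]⟩
      invFun := fun q => ⟨fun n => r (q.1 (n + L)), fun i => by
        rw [hr, Nat.add_right_comm, q.2]⟩
      left_inv := fun x => Subtype.ext (funext fun n =>
        (congrFun H.r_comp_s _).trans (iterate_coord x L n))
      right_inv := fun q => Subtype.ext (funext fun n =>
        (congrFun H.s_comp_r _).trans (iterate_coord q L n))
      continuous_toFun := Continuous.subtype_mk (continuous_pi fun n =>
        H.continuous_s.comp ((continuous_apply n).comp continuous_subtype_val)) _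
      continuous_invFun := Continuous.subtype_mk (continuous_pi fun n =>
        H.continuous_r.comp ((continuous_apply (n + L)).comp continuous_subtype_val)) _ }
  exact ⟨S, fun x n => rfl, S.isHomeomorph, fun x => Subtype.ext (funext fun n => (hs _).symm)⟩

variable {Y : Type*} [MetricSpace Y] [CompactSpace Y] {g : Y → Y} {β γ : ℝ} {K : ℕ}
  {P : Set (InverseLimit g)} {εY : ℝ}

theorem WielerAxioms.continuous_rMap (hW : WielerAxioms g β γ K) :
    Continuous (rMap γ K P εY) :=
  continuous_quot_lift _ hW.continuous_pi0

theorem WielerAxioms.surjective_rMap (hW : WielerAxioms g β γ K)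
    (hd : Dense (unstableSet γ K P)) : Function.Surjective (rMap γ K P εY) := by
  intro y
  obtain ⟨x, rfl⟩ := exists_coord_zero_eq hW.surjective y
  obtain ⟨z, hz⟩ := hW.exists_coord_eq hd x 0
  exact ⟨cls εY z, hz 0 le_rfl⟩

omit [CompactSpace Y] in
theorem continuous_cls : Continuous (cls εY : XuP γ K P → XuPQuot γ K P εY) :=
  continuous_quot_mk

/-- A section `s` of classes with prescribed first coordinates is continuous: it suffices to check
this on the solenoid, of which `Y` is a quotient, and there it follows by lifting. -/
theorem WielerAxioms.continuous_section (hW : WielerAxioms g β γ K)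
    (hd : Dense (unstableSet γ K P)) {K₀ : ℕ} {s : Y → XuPQuot γ K P εY}
    (hs : ∀ (y : Y) (z : XuP γ K P), (∀ i ≤ K₀, z.val.1 i = g^[K₀ - i] y) → s y = cls εY z) :
    Continuous s := by
  refine (isQuotientMap_coord_zero hW.continuous hW.surjective).continuous_iff.2
    (continuous_iff_continuousAt.2 fun x V hV => ?_)
  obtain ⟨z, hz⟩ := hW.exists_coord_eq hd ((shift g)^[K₀] x) (K₀ + K)
  have hsx : s (x.1 0) = cls εY z := hs _ _ fun i hi => by
    rw [hz i (by omega), shift_iterate_coord_sub x hi]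
  have hV' : cls εY ⁻¹' V ∈ 𝓝 z := continuous_cls.continuousAt (by
    have : V ∈ 𝓝 (s (x.1 0)) := hV
    rwa [hsx] at this)
  obtain ⟨ε, hε, hεV⟩ := hW.mem_nhds_iff.1 hV'
  obtain ⟨δ, hδ, hl⟩ := hW.exists_lift K₀ (lt_min hε hW.β_pos)
  have hzK : z.val.1 (K₀ + K) = x.1 K := by
    rw [hz _ le_rfl, shift_iterate_coord, add_comm, iterate_coord]
  have hnear : ∀ᶠ x' : InverseLimit g in 𝓝 x, dist (x'.1 K) (x.1 K) < δ :=
    Metric.tendsto_nhds.1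
      (((continuous_apply K).comp continuous_subtype_val).tendsto x) δ hδ
  refine mem_map.2 ?_
  filter_upwards [hnear] with x' hx'
  obtain ⟨v, hv, hzv⟩ := hl z.val (x'.1 K) (by rwa [hzK])
  have hx0 : g^[K] (x'.1 K) = x'.1 0 := by
    have := iterate_coord x' K 0
    rwa [Nat.zero_add] at this
  have hvu : v ∈ unstableSet γ K P := hW.mem_unstableSet_of_dist_le z.mem fun n =>
    ((hzv n).trans_le (min_le_right _ _)).le
  change s (x'.1 0) ∈ V
  rw [hs (x'.1 0) ⟨v, hvu⟩ fun i hi => by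
    rw [← hx0, ← hv]
    exact (iterate_coord_of_le v hi).symm]
  exact hεV ⟨v, hvu⟩ fun n => (hzv n).trans_le (min_le_left _ _)

/-- The map `g̃` of `X^u(P)/∼₀` induced by `φ`. -/
noncomputable def quotShift (hW : WielerAxioms g β γ K) (hε : 0 < εY) (hεβ : εY ≤ β / 2)
    (hP : shift g '' P = P) : XuPQuot γ K P εY → XuPQuot γ K P εY :=
  Quot.map (shiftU hP) fun _ _ h => h.shiftU hW hε hεβ hP

theorem continuous_quotShift (hW : WielerAxioms g β γ K) (hε : 0 < εY) (hεβ : εY ≤ β / 2)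
    (hP : shift g '' P = P) : Continuous (quotShift hW hε hεβ hP) :=
  continuous_quot_lift _ (continuous_cls.comp (shiftHomeo hW hP).continuous)

theorem quotShift_iterate_cls (hW : WielerAxioms g β γ K) (hε : 0 < εY) (hεβ : εY ≤ β / 2)
    (hP : shift g '' P = P) (n : ℕ) (x : XuP γ K P) :
    (quotShift hW hε hεβ hP)^[n] (cls εY x) = cls εY ((shiftU hP)^[n] x) := by
  induction n generalizing x with
  | zero => rfl
  | succ n ih => exact ih (shiftU hP x)

omit [CompactSpace Y] in
theorem shiftU_iterate_val (hP : shift g '' P = P) (n : ℕ) (x : XuP γ K P) :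
    ((shiftU hP)^[n] x).val = (shift g)^[n] x.val := by
  induction n generalizing x with
  | zero => rfl
  | succ n ih => exact ih (shiftU hP x)

theorem exists_isShiftEquivalence (hW : WielerAxioms g β γ K) (hε : 0 < εY) (hεβ : εY ≤ β / 2)
    (hP : shift g '' P = P) (hd : Dense (unstableSet γ K P)) (K₀ : ℕ)
    (hK₀ : ∀ x y : XuP γ K P, (∀ i ≤ K₀, x.val.1 i = y.val.1 i) → SimZero εY x y) :
    ∃ s : Y → XuPQuot γ K P εY,
      (∀ (y : Y) (z : XuP γ K P),
        (∀ i ≤ K₀, z.val.1 i = g^[K₀ - i] y) → s y = cls εY z) ∧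
      IsShiftEquivalence (quotShift hW hε hεβ hP) g (rMap γ K P εY) s K₀ := by
  have hex : ∀ y : Y, ∃ z : XuP γ K P, ∀ i ≤ K₀, z.val.1 i = g^[K₀ - i] y := by
    intro y
    obtain ⟨x, rfl⟩ := exists_coord_zero_eq hW.surjective y
    obtain ⟨z, hz⟩ := hW.exists_coord_eq hd ((shift g)^[K₀] x) K₀
    exact ⟨z, fun i hi => by rw [hz i hi, shift_iterate_coord_sub x hi]⟩
  choose f hf using hex
  have hs : ∀ (y : Y) (z : XuP γ K P),
      (∀ i ≤ K₀, z.val.1 i = g^[K₀ - i] y) → cls εY (f y) = cls εY z := fun y z hz =>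
    Quot.sound (hK₀ _ _ fun i hi => by rw [hf y i hi, hz i hi])
  refine ⟨fun y => cls εY (f y), hs,
    { continuous_r := hW.continuous_rMap
      continuous_s := hW.continuous_section hd hs
      r_comp := funext fun q => ?_
      s_comp := funext fun y => hs _ (shiftU hP (f y)) fun i hi => ?_
      r_comp_s := funext fun y => hf y 0 K₀.zero_le
      s_comp_r := funext fun q => ?_ }⟩
  · induction q using Quot.ind
    rfl
  · change g ((f y).val.1 i) = _
    rw [hf y i hi, ← Function.iterate_succ_apply' g, ← Function.iterate_succ_apply]
  · induction q using Quot.ind with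
    | _ x =>
      change cls εY (f (x.val.1 0)) = (quotShift hW hε hεβ hP)^[K₀] (cls εY x)
      rw [quotShift_iterate_cls]
      refine hs _ _ fun i hi => ?_
      rw [shiftU_iterate_val, shift_iterate_coord_sub x.val hi]

end ShiftEquivalence

/-! ### Brackets of nearby points in a Smale space -/

namespace SmaleSpace

variable {X : Type*} [MetricSpace X] {φ : X ≃ₜ X} (B : SmaleSpace φ)

theorem continuousAt_bracket {x y : X} (h : dist x y < B.ε) :
    ContinuousAt (fun p : X × X => B.bracket p.1 p.2) (x, y) :=
  B.continuousOn_bracket.continuousAt <|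
    mem_of_superset ((isOpen_lt continuous_dist continuous_const).mem_nhds h)
      fun p (hp : dist p.1 p.2 < B.ε) => hp.le

theorem tendsto_bracket_left {x y : X} (h : dist x y < B.ε) :
    Tendsto (fun u => B.bracket u y) (𝓝 x) (𝓝 (B.bracket x y)) :=
  (B.continuousAt_bracket h).tendsto.comp ((Continuous.prodMk_left y).tendsto x)

theorem tendsto_bracket_right {x y : X} (h : dist x y < B.ε) :
    Tendsto (fun u => B.bracket x u) (𝓝 y) (𝓝 (B.bracket x y)) :=
  (B.continuousAt_bracket h).tendsto.comp ((Continuous.prodMk_right x).tendsto y)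

theorem exists_dist_bracket_bracket_lt [CompactSpace X] {η : ℝ} (hη : 0 < η) :
    ∃ δ > 0, ∀ x y x' y' : X, dist x y ≤ B.ε → dist x' y' ≤ B.ε → dist x x' < δ →
      dist y y' < δ → dist (B.bracket x y) (B.bracket x' y') < η := by
  have hc : IsCompact {p : X × X | dist p.1 p.2 ≤ B.ε} :=
    (isClosed_le continuous_dist continuous_const).isCompact
  obtain ⟨δ, hδ, h⟩ := Metric.uniformContinuousOn_iff.1
    (hc.uniformContinuousOn_of_continuous B.continuousOn_bracket) η hη
  exact ⟨δ, hδ, fun x y x' y' hxy hxy' h1 h2 => h (x, y) hxy (x', y') hxy' (max_lt h1 h2)⟩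

theorem exists_dist_bracket_lt [CompactSpace X] {η : ℝ} (hη : 0 < η) :
    ∃ δ > 0, ∀ x u t : X, dist x u < δ → dist x t < δ → dist x (B.bracket u t) < η := by
  obtain ⟨δ, hδ, h⟩ := B.exists_dist_bracket_bracket_lt hη
  have hε := B.ε_pos
  refine ⟨min δ (B.ε / 2), lt_min hδ (half_pos hε), fun x u t hu ht => ?_⟩
  have h1 := h x x u t (by rw [dist_self]; exact hε.le) ?_ (hu.trans_le (min_le_left _ _))
    (ht.trans_le (min_le_left _ _))
  · rwa [B.B1] at h1
  · linarith [dist_triangle_left u t x, hu.trans_le (min_le_right _ _),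
      ht.trans_le (min_le_right _ _)]

/-- A scale `r` at which brackets of three nearby points satisfy the absorption laws. -/
structure IsSmall (r : ℝ) : Prop where
  pos : 0 < r
  le : r ≤ B.ε / 4
  dist_bracket : ∀ x y, dist x y < r → dist x (B.bracket x y) < B.ε / 4

theorem exists_isSmall [CompactSpace X] : ∃ r, B.IsSmall r := by
  have hε : 0 < B.ε / 4 := by linarith [B.ε_pos]
  obtain ⟨δ, hδ, h⟩ := B.exists_dist_bracket_lt hε
  exact ⟨min δ (B.ε / 4), lt_min hδ hε, min_le_right _ _, fun x y hxy =>
    h x x y (by rwa [dist_self]) (hxy.trans_le (min_le_left _ _))⟩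

variable {B} {r : ℝ}

theorem IsSmall.lt_ε (hr : B.IsSmall r) : r < B.ε := by
  linarith [hr.le, B.ε_pos]

theorem IsSmall.bracket_bracket_right (hr : B.IsSmall r) {x y z : X} (hxy : dist x y < r)
    (hyz : dist y z < r) (hxz : dist x z < r) :
    B.bracket x (B.bracket y z) = B.bracket x z := by
  have := hr.lt_ε
  refine B.B2 x y z (by linarith) ?_ (by linarith)
  linarith [dist_triangle x y (B.bracket y z), hr.dist_bracket y z hyz, hr.le, B.ε_pos]

theorem IsSmall.bracket_bracket_left (hr : B.IsSmall r) {x y z : X} (hxy : dist x y < r)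
    (hxz : dist x z < r) : B.bracket (B.bracket x y) z = B.bracket x z := by
  have := hr.lt_ε
  refine B.B3 x y z (by linarith) ?_ (by linarith)
  linarith [dist_triangle_left (B.bracket x y) z x, hr.dist_bracket x y hxy, hr.le, B.ε_pos]

theorem IsSmall.stable_symm (hr : B.IsSmall r) {x y : X} (hxy : dist x y < r)
    (h : B.bracket x y = y) : B.bracket y x = x := by
  have := hr.bracket_bracket_left (z := x) hxy (by rw [dist_self]; exact hr.pos)
  rwa [h, B.B1] at this

theorem IsSmall.stable_trans (hr : B.IsSmall r) {x y z : X} (hxy : dist x y < r)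
    (hxz : dist x z < r) (h : B.bracket x y = y) (h' : B.bracket y z = z) :
    B.bracket x z = z := by
  have := hr.bracket_bracket_left hxy hxz
  rw [h, h'] at this
  exact this.symm

theorem stable_map {x y : X} (hxy : dist x y ≤ B.ε) (h : B.bracket x y = y) :
    B.bracket (φ x) (φ y) = φ y ∧ dist (φ x) (φ y) ≤ B.lam * dist x y := by
  have h1 := B.C1 x y hxy h
  have h2 : dist (φ x) (φ y) ≤ B.ε :=
    h1.trans ((mul_le_of_le_one_left dist_nonneg B.lam_lt_one.le).trans hxy)
  refine ⟨?_, h1⟩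
  rw [← B.B4 x y hxy h2, h]

theorem stable_iterate {x y : X} (hxy : dist x y ≤ B.ε) (h : B.bracket x y = y) (n : ℕ) :
    B.bracket (φ^[n] x) (φ^[n] y) = φ^[n] y ∧
      dist (φ^[n] x) (φ^[n] y) ≤ B.lam ^ n * dist x y := by
  induction n with
  | zero => simpa using h
  | succ n ih =>
    have h1 : dist (φ^[n] x) (φ^[n] y) ≤ dist x y :=
      ih.2.trans (mul_le_of_le_one_left dist_nonneg (pow_le_one₀ B.lam_pos.le B.lam_lt_one.le))
    obtain ⟨h2, h3⟩ := stable_map (h1.trans hxy) ih.1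
    rw [Function.iterate_succ_apply', Function.iterate_succ_apply', pow_succ', mul_assoc]
    exact ⟨h2, h3.trans (mul_le_mul_of_nonneg_left ih.2 B.lam_pos.le)⟩

theorem stable_iterate_le {x y : X} (hxy : dist x y ≤ B.ε) (h : B.bracket x y = y) (n : ℕ) :
    dist (φ^[n] x) (φ^[n] y) ≤ dist x y :=
  (stable_iterate hxy h n).2.trans
    (mul_le_of_le_one_left dist_nonneg (pow_le_one₀ B.lam_pos.le B.lam_lt_one.le))

theorem tendsto_lam_pow_mul (B : SmaleSpace φ) (a : ℝ) :
    Tendsto (fun n : ℕ => B.lam ^ n * a) atTop (𝓝 0) := by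
  simpa using (tendsto_pow_atTop_nhds_zero_of_lt_one B.lam_pos.le B.lam_lt_one).mul_const a

/-- Points whose forward orbits stay close lie on a common local stable set: the unstable component
of their displacement, which is expanded by `φ`, vanishes. -/
theorem IsSmall.stable_of_forall_dist_lt (hr : B.IsSmall r) {x y : X}
    (h : ∀ n : ℕ, dist (φ^[n] x) (φ^[n] y) < r) : B.bracket x y = y := by
  have hlt := hr.lt_ε
  have hw : ∀ n : ℕ, φ^[n] (B.bracket x y) = B.bracket (φ^[n] x) (φ^[n] y) := by
    intro n
    induction n with
    | zero => rfl
    | succ n ih =>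
      have h1 := h (n + 1)
      simp only [Function.iterate_succ_apply'] at h1 ⊢
      rw [ih, B.B4 _ _ ((h n).le.trans hlt.le) (h1.le.trans hlt.le)]
  have hd : ∀ n : ℕ, dist (φ^[n] (B.bracket x y)) (φ^[n] y) ≤ B.ε := by
    intro n
    rw [hw]
    linarith [dist_triangle_left (B.bracket (φ^[n] x) (φ^[n] y)) (φ^[n] y) (φ^[n] x),
      hr.dist_bracket _ _ (h n), h n, hr.le, B.ε_pos]
  have hstep : ∀ n : ℕ, dist (φ^[n] (B.bracket x y)) (φ^[n] y) ≤
      B.lam * dist (φ^[n + 1] (B.bracket x y)) (φ^[n + 1] y) := by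
    intro n
    have h1 := B.C2 _ _ (hd (n + 1)) (by
      rw [hw]
      exact hr.bracket_bracket_left (h _) (h _))
    simpa only [Function.iterate_succ_apply', Homeomorph.symm_apply_apply] using h1
  have hn : ∀ n : ℕ, dist (B.bracket x y) y ≤ B.lam ^ n * B.ε := by
    have h1 : ∀ n : ℕ, dist (B.bracket x y) y ≤
        B.lam ^ n * dist (φ^[n] (B.bracket x y)) (φ^[n] y) := by
      intro n
      induction n with
      | zero => simp
      | succ n ih =>
        rw [pow_succ, mul_assoc]
        exact ih.trans (mul_le_mul_of_nonneg_left (hstep n) (pow_pos B.lam_pos n).le)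
    exact fun n => (h1 n).trans (mul_le_mul_of_nonneg_left (hd n) (pow_pos B.lam_pos n).le)
  exact dist_le_zero.1 (ge_of_tendsto' (B.tendsto_lam_pow_mul B.ε) hn)

/-! ### Clopen pieces of local stable sets -/

/-- In a totally disconnected stable set, small clopen neighbourhoods exist in the compact local
stable set. -/
theorem IsSmall.exists_clopen_piece [CompactSpace X] (hr : B.IsSmall r) (x : X)
    [TotallyDisconnectedSpace (B.StableSet x)] {κ : ℝ} (hκ : 0 < κ) :
    ∃ T ⊆ {y | dist x y ≤ r / 2 ∧ B.bracket x y = y}, x ∈ T ∧ T ⊆ Metric.ball x κ ∧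
      IsClosed T ∧ IsClosed ({y | dist x y ≤ r / 2 ∧ B.bracket x y = y} \ T) := by
  set D : Set X := {y | dist x y ≤ r / 2 ∧ B.bracket x y = y}
  have hrpos := hr.pos
  have hlt := hr.lt_ε
  have hDr : ∀ y ∈ D, dist x y < r := fun y hy => by linarith [hy.1]
  have hD : IsClosed D := by
    refine isClosed_iff_clusterPt.2 fun y hy => ?_
    have hy1 : dist x y ≤ r / 2 := by
      have hcl : IsClosed {y | dist x y ≤ r / 2} :=
        isClosed_le (continuous_const.dist continuous_id) continuous_const
      exact isClosed_iff_clusterPt.1 hcl y (hy.mono (principal_mono.2 fun z hz => hz.1))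
    refine ⟨hy1, ?_⟩
    have hne : (𝓝 y ⊓ 𝓟 D).NeBot := hy
    refine tendsto_nhds_unique (f := fun z : X => z) (l := 𝓝 y ⊓ 𝓟 D) ?_ inf_le_left
    refine ((B.tendsto_bracket_right (x := x) (y := y) (by linarith)).mono_left
      inf_le_left).congr' ?_
    filter_upwards [mem_inf_of_right (mem_principal_self D)] with z hz using hz.2
  let f : D → B.StableSet x := fun y => ⟨y.1, by
    refine squeeze_zero (fun _ => dist_nonneg) (fun n => ?_) (B.tendsto_lam_pow_mul (dist x y.1))
    rw [dist_comm]
    exact (stable_iterate ((hDr _ y.2).trans hlt).le y.2.2 n).2⟩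
  have hfc : Continuous f := by
    refine ⟨fun U hU => Metric.isOpen_iff.2 fun y hy => ?_⟩
    obtain ⟨δ, hδ, h⟩ := hU (f y) hy
    refine ⟨min δ r, lt_min hδ hrpos, fun z hz => h (f z) ⟨?_, ?_⟩⟩
    · change B.bracket y.1 z.1 = z.1
      have := hr.bracket_bracket_left (hDr _ y.2) (hDr _ z.2)
      rwa [y.2.2, z.2.2] at this
    · rw [dist_comm]
      exact (Metric.mem_ball.1 hz).trans_le (min_le_left _ _)
  have hfi : Function.Injective f := fun y z h => Subtype.ext (congrArg StableSet.val h)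
  have : TotallyDisconnectedSpace D := ⟨isTotallyDisconnected_of_image hfc.continuousOn hfi
    (isTotallyDisconnected_of_totallyDisconnectedSpace _)⟩
  have : CompactSpace D := isCompact_iff_compactSpace.1 hD.isCompact
  have hxD : x ∈ D := ⟨by rw [dist_self]; positivity, B.B1 x⟩
  obtain ⟨V, hV, hxV, hVκ⟩ := compact_exists_isClopen_in_isOpen
    (Metric.isOpen_ball (x := (⟨x, hxD⟩ : D)) (ε := κ)) (Metric.mem_ball_self hκ)
  have hemb := hD.isClosedEmbedding_subtypeVal
  refine ⟨Subtype.val '' V, ?_, ⟨_, hxV, rfl⟩, ?_, hemb.isClosedMap _ hV.1, ?_⟩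
  · rintro _ ⟨y, -, rfl⟩
    exact y.2
  · rintro _ ⟨y, hy, rfl⟩
    exact hVκ hy
  · have : D \ Subtype.val '' V = Subtype.val '' Vᶜ := by
      rw [image_compl_eq_range_sdiff_image Subtype.val_injective, Subtype.range_coe]
    rw [this]
    exact hemb.isClosedMap _ hV.compl.1

/-- Every point has a small neighbourhood, a product of an unstable piece and a clopen stable
piece, that is invariant under small displacements in the stable direction. -/
theorem IsSmall.exists_rectangle [CompactSpace X] (hr : B.IsSmall r) (x : X)
    [TotallyDisconnectedSpace (B.StableSet x)] {η : ℝ} (hη : 0 < η) :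
    ∃ R ∈ 𝓝 x, (∀ z ∈ R, dist x z < η) ∧ ∃ δ > 0, ∀ z z', dist z z' < δ →
      B.bracket z z' = z' → z ∈ R → z' ∈ R := by
  have hrpos := hr.pos
  have hlt := hr.lt_ε
  obtain ⟨ρ, hρ, hρD⟩ := B.exists_dist_bracket_lt (half_pos hrpos)
  set ρ' := min ρ (r / 2)
  have hρ' : 0 < ρ' := lt_min hρ (half_pos hrpos)
  have hρ'r : ρ' ≤ r / 2 := min_le_right _ _
  obtain ⟨κ, hκ, hκρ⟩ := B.exists_dist_bracket_lt (half_pos (lt_min hρ' hη))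
  obtain ⟨T, hTD, hxT, hTκ, hT, hDT⟩ := hr.exists_clopen_piece x hκ
  have hself : ∀ y : X, dist y y < r := fun y => by rwa [dist_self]
  have hmemD : ∀ z, dist x z < ρ' →
      B.bracket x z ∈ {y | dist x y ≤ r / 2 ∧ B.bracket x y = y} := fun z hz =>
    ⟨(hρD x x z (by rwa [dist_self]) (hz.trans_le (min_le_left _ _))).le,
      hr.bracket_bracket_right (hself x) (by linarith) (by linarith)⟩
  let R : Set X := {z | dist x z < ρ' ∧ dist x (B.bracket z x) < κ ∧ B.bracket x z ∈ T}
  -- A point of `R` is the bracket of its two components, hence is closer to `x` than required.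
  have hRdist : ∀ z ∈ R, dist x z < min ρ' η / 2 := by
    rintro z ⟨hz, hz1, hz2⟩
    have hzx : dist z x < r := by rw [dist_comm]; linarith
    have h1 : B.bracket (B.bracket z x) (B.bracket x z) = z := by
      rw [hr.bracket_bracket_left hzx, hr.bracket_bracket_right hzx (by linarith) (hself z), B.B1]
      linarith [dist_triangle_left z (B.bracket x z) x, (hTD hz2).1]
    have h2 := hκρ x _ _ hz1 (by
      rw [dist_comm]
      exact hTκ hz2)
    rwa [h1] at h2
  refine ⟨R, ?_, fun z hz => ?_, ?_⟩
  · have h1 : ∀ᶠ z in 𝓝 x, dist x z < ρ' :=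
      (isOpen_lt (continuous_const.dist continuous_id) continuous_const).mem_nhds
        (by simpa using hρ')
    have hxx : dist x x < B.ε := (hself x).trans hlt
    have h2 : ∀ᶠ z in 𝓝 x, dist x (B.bracket z x) < κ := by
      have := (tendsto_const_nhds (x := x)).dist (B.tendsto_bracket_left hxx)
      rw [B.B1, dist_self] at this
      exact this.eventually (gt_mem_nhds hκ)
    have h3 : ∀ᶠ z in 𝓝 x, B.bracket x z ∈
        ({y | dist x y ≤ r / 2 ∧ B.bracket x y = y} \ T)ᶜ := by
      have := B.tendsto_bracket_right hxx
      rw [B.B1] at this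
      exact this.eventually (hDT.isOpen_compl.mem_nhds fun h => h.2 hxT)
    filter_upwards [h1, h2, h3] with z hz1 hz2 hz3
    refine ⟨hz1, hz2, ?_⟩
    by_contra hz4
    exact hz3 ⟨hmemD z hz1, hz4⟩
  · linarith [hRdist z hz, min_le_right ρ' η]
  · have hdisj : Disjoint T ({y | dist x y ≤ r / 2 ∧ B.bracket x y = y} \ T) :=
      disjoint_sdiff_right
    obtain ⟨σ, hσ, hσT⟩ := hdisj.exists_thickenings hT.isCompact hDT
    obtain ⟨δ, hδ, hδσ⟩ := B.exists_dist_bracket_bracket_lt hσ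
    refine ⟨min δ (ρ' / 2), lt_min hδ (half_pos hρ'), fun z z' hzz' hst hz => ?_⟩
    have hzz1 := hzz'.trans_le (min_le_left _ _)
    have hzz2 := hzz'.trans_le (min_le_right _ _)
    have hxz := hRdist z hz
    have hxz' : dist x z' < ρ' := by
      linarith [dist_triangle x z z', min_le_left ρ' η]
    refine ⟨hxz', ?_, ?_⟩
    · have := hr.bracket_bracket_left (x := z) (y := z') (z := x) (by linarith)
        (by rw [dist_comm]; linarith [hz.1])
      rw [hst] at this
      rw [this]
      exact hz.2.1
    · by_contra hT'
      have h1 := hδσ x z x z' (by linarith [hz.1]) (by linarith) (by rwa [dist_self]) hzz1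
      refine disjoint_left.1 hσT (Metric.self_subset_thickening hσ _ hz.2.2)
        (Metric.mem_thickening_iff.2 ⟨_, ⟨hmemD z' hxz', hT'⟩, h1⟩)

/-! ### Labellings and their holonomy relation -/

variable {α : Type*} {δ : ℝ} {c : X → α}

/-- A labelling `c` of the points of a Smale space at the scale `r`: points with the same label are
close, the label does not change under displacements by less than `δ` in the stable direction, and
the label of a point determines that of its image. -/
structure IsLabelling (B : SmaleSpace φ) (r δ : ℝ) (c : X → α) : Prop where
  small : B.IsSmall r
  pos : 0 < δ
  le : δ ≤ r
  dist_lt : ∀ z w, c z = c w → dist z w < r / 8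
  eq_of_stable : ∀ z w, dist z w < δ → B.bracket z w = w → c z = c w
  map : ∀ z w, c z = c w → c (φ z) = c (φ w)

theorem exists_pos_forall_le {ι : Type*} (t : Finset ι) (d : ι → ℝ)
    (hd : ∀ i, 0 < d i) : ∃ δ > 0, ∀ i ∈ t, δ ≤ d i := by
  classical
  induction t using Finset.induction_on with
  | empty => exact ⟨1, one_pos, by simp⟩
  | insert a t _ ih =>
    obtain ⟨δ, hδ, h⟩ := ih
    refine ⟨min δ (d a), lt_min hδ (hd a), fun i hi => ?_⟩
    rcases Finset.mem_insert.1 hi with rfl | hi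
    · exact min_le_right _ _
    · exact (min_le_left _ _).trans (h i hi)

/-- The label of `z` records which rectangles of a finite cover the points of the forward orbit of
`z` lie in. -/
theorem IsSmall.exists_isLabelling [CompactSpace X] (hr : B.IsSmall r)
    (hB : ∀ x, TotallyDisconnectedSpace (B.StableSet x)) :
    ∃ (δ : ℝ) (c : X → ℕ → Set X), B.IsLabelling r δ c := by
  have hr16 : 0 < r / 16 := by linarith [hr.pos]
  choose R hR hRη d hd hRd using fun x => hr.exists_rectangle x hr16
  obtain ⟨t, ht⟩ := CompactSpace.elim_nhds_subcover R hR
  obtain ⟨δ, hδ, hδd⟩ := exists_pos_forall_le t d hd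
  have hδr : min δ r ≤ r := min_le_right _ _
  refine ⟨min δ r, fun z n => {x | x ∈ t ∧ φ^[n] z ∈ R x}, hr, lt_min hδ hr.pos, hδr,
    fun z w h => ?_, fun z w hzw hst => ?_, fun z w h => ?_⟩
  · have hz : z ∈ ⋃ x ∈ t, R x := ht ▸ mem_univ z
    simp only [mem_iUnion] at hz
    obtain ⟨x, hx, hzx⟩ := hz
    have hw : x ∈ {x | x ∈ t ∧ φ^[0] w ∈ R x} := (congrFun h 0) ▸ ⟨hx, hzx⟩
    linarith [dist_triangle_left z w x, hRη x z hzx, hRη x w hw.2]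
  · have hε : dist z w ≤ B.ε := by linarith [hr.lt_ε]
    funext n
    have hst' := (stable_iterate hε hst n).1
    have hd' := (stable_iterate_le hε hst n).trans_lt hzw
    ext x
    refine and_congr_right fun hx => ⟨fun h => ?_, fun h => ?_⟩
    · exact hRd x _ _ (hd'.trans_le ((min_le_left _ _).trans (hδd x hx))) hst' h
    · have hst2 := hr.stable_symm (hd'.trans_le hδr) hst'
      rw [dist_comm] at hd'
      exact hRd x _ _ (hd'.trans_le ((min_le_left _ _).trans (hδd x hx))) hst2 h
  · funext n
    exact congrFun h (n + 1)

/-- The holonomy relation of a labelling: `z` and `w` lie on a common local stable set, and the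
holonomy `u ↦ [u, w]` preserves labels near `z`. -/
def HolonomyRel (B : SmaleSpace φ) (r : ℝ) (c : X → α) (z w : X) : Prop :=
  dist z w < r ∧ B.bracket z w = w ∧ ∀ᶠ u in 𝓝 z, c u = c (B.bracket u w)

namespace IsLabelling

theorem eventually_bracket_self (h : B.IsLabelling r δ c) (z : X) :
    ∀ᶠ u in 𝓝 z, c u = c (B.bracket u z) := by
  have hr := h.small
  have h1 : Tendsto (fun u => dist u (B.bracket u z)) (𝓝 z) (𝓝 0) := by
    have := (tendsto_id (x := 𝓝 z)).dist (B.tendsto_bracket_left (x := z) (y := z)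
      (by rw [dist_self]; exact B.ε_pos))
    rwa [B.B1, dist_self] at this
  filter_upwards [h1.eventually (gt_mem_nhds h.pos), Metric.ball_mem_nhds z hr.pos] with u hu huz
  exact h.eq_of_stable _ _ hu
    (hr.bracket_bracket_right (by rw [dist_self]; exact hr.pos) huz huz)

theorem dist_lt_of_rel (h : B.IsLabelling r δ c) {z w : X} (hzw : B.HolonomyRel r c z w) :
    dist z w < r / 8 := by
  have h1 := hzw.2.2.self_of_nhds
  rw [hzw.2.1] at h1
  exact h.dist_lt _ _ h1

theorem tendsto_of_rel (h : B.IsLabelling r δ c) {z w : X} (hzw : B.HolonomyRel r c z w) :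
    Tendsto (fun u => B.bracket u w) (𝓝 z) (𝓝 w) := by
  have := B.tendsto_bracket_left (hzw.1.trans h.small.lt_ε)
  rwa [hzw.2.1] at this

theorem rel_of_stable (h : B.IsLabelling r δ c) {z w : X} (hzw : dist z w < δ)
    (hst : B.bracket z w = w) : B.HolonomyRel r c z w := by
  have hr := h.small
  have hzr := hzw.trans_le h.le
  refine ⟨hzr, hst, ?_⟩
  have h1 : Tendsto (fun u => dist u (B.bracket u w)) (𝓝 z) (𝓝 (dist z w)) := by
    have := (tendsto_id (x := 𝓝 z)).dist (B.tendsto_bracket_left (hzr.trans hr.lt_ε))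
    rwa [hst] at this
  have h2 : Tendsto (fun u => dist u w) (𝓝 z) (𝓝 (dist z w)) :=
    tendsto_id.dist tendsto_const_nhds
  filter_upwards [h1.eventually (gt_mem_nhds hzw), h2.eventually (gt_mem_nhds hzr)] with u hu huw
  exact h.eq_of_stable _ _ hu
    (hr.bracket_bracket_right (by rw [dist_self]; exact hr.pos) huw huw)

theorem rel_refl (h : B.IsLabelling r δ c) (z : X) : B.HolonomyRel r c z z :=
  h.rel_of_stable (by rw [dist_self]; exact h.pos) (B.B1 z)

theorem rel_symm (h : B.IsLabelling r δ c) {z w : X} (hzw : B.HolonomyRel r c z w) :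
    B.HolonomyRel r c w z := by
  have hr := h.small
  have hst := hr.stable_symm hzw.1 hzw.2.1
  have hwz : dist w z < r := by rw [dist_comm]; exact hzw.1
  refine ⟨hwz, hst, ?_⟩
  have h1 : Tendsto (fun v => B.bracket v z) (𝓝 w) (𝓝 z) := by
    have := B.tendsto_bracket_left (hwz.trans hr.lt_ε)
    rwa [hst] at this
  have h2 : Tendsto (fun u => dist u z) (𝓝 w) (𝓝 (dist w z)) :=
    tendsto_id.dist tendsto_const_nhds
  filter_upwards [h1.eventually hzw.2.2, h.eventually_bracket_self w,
    h2.eventually (gt_mem_nhds hwz), Metric.ball_mem_nhds w hr.pos] with v hv1 hv2 hv3 hv4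
  rw [hv1, hr.bracket_bracket_left hv3 hv4, hv2]

theorem rel_trans (h : B.IsLabelling r δ c) {z w v : X} (hzw : B.HolonomyRel r c z w)
    (hwv : B.HolonomyRel r c w v) : B.HolonomyRel r c z v := by
  have hr := h.small
  have hrpos := hr.pos
  have hzv : dist z v < r := by
    linarith [dist_triangle z w v, h.dist_lt_of_rel hzw, h.dist_lt_of_rel hwv]
  refine ⟨hzv, hr.stable_trans hzw.1 hzv hzw.2.1 hwv.2.1, ?_⟩
  have h1 : ∀ y, Tendsto (fun u => dist u y) (𝓝 z) (𝓝 (dist z y)) := fun y =>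
    tendsto_id.dist tendsto_const_nhds
  filter_upwards [hzw.2.2, (h.tendsto_of_rel hzw).eventually hwv.2.2,
    (h1 w).eventually (gt_mem_nhds hzw.1), (h1 v).eventually (gt_mem_nhds hzv)] with u h2 h3 h4 h5
  rw [h2, h3, hr.bracket_bracket_left h4 h5]

/-- The holonomy relation is open: it persists along the holonomy. -/
theorem eventually_rel (h : B.IsLabelling r δ c) {z w : X} (hzw : B.HolonomyRel r c z w) :
    ∀ᶠ u in 𝓝 z, B.HolonomyRel r c u (B.bracket u w) := by
  have hr := h.small
  have hdist : ∀ a b : X, Tendsto (fun u => dist u b) (𝓝 a) (𝓝 (dist a b)) := fun a b =>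
    tendsto_id.dist tendsto_const_nhds
  have h1 : Tendsto (fun u => dist u (B.bracket u w)) (𝓝 z) (𝓝 (dist z w)) :=
    tendsto_id.dist (h.tendsto_of_rel hzw)
  filter_upwards [h1.eventually (gt_mem_nhds hzw.1), (hdist z w).eventually (gt_mem_nhds hzw.1),
    eventually_eventually_nhds.2 hzw.2.2] with u hu1 hu2 hu3
  refine ⟨hu1, hr.bracket_bracket_right (by rw [dist_self]; exact hr.pos) hu2 hu2, ?_⟩
  filter_upwards [hu3, (hdist u w).eventually (gt_mem_nhds hu2),
    Metric.ball_mem_nhds u hr.pos] with v hv1 hv2 hv3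
  rw [hv1, hr.bracket_bracket_right hv3 hu2 hv2]

theorem rel_map (h : B.IsLabelling r δ c) {z w : X} (hzw : B.HolonomyRel r c z w) :
    B.HolonomyRel r c (φ z) (φ w) := by
  have hr := h.small
  obtain ⟨h1, h2⟩ := stable_map (hzw.1.trans hr.lt_ε).le hzw.2.1
  have h3 : dist (φ z) (φ w) < r :=
    (h2.trans (mul_le_of_le_one_left dist_nonneg B.lam_lt_one.le)).trans_lt hzw.1
  refine ⟨h3, h1, ?_⟩
  have h4 : Tendsto φ.symm (𝓝 (φ z)) (𝓝 z) := by
    have := φ.symm.continuous.tendsto (φ z)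
    rwa [φ.symm_apply_apply] at this
  have hdist : ∀ a b : X, Tendsto (fun u => dist u b) (𝓝 a) (𝓝 (dist a b)) := fun a b =>
    tendsto_id.dist tendsto_const_nhds
  filter_upwards [h4.eventually hzw.2.2, (hdist (φ z) (φ w)).eventually (gt_mem_nhds h3),
    h4.eventually ((hdist z w).eventually (gt_mem_nhds hzw.1))] with u hu1 hu2 hu3
  have h5 := h.map _ _ hu1
  rwa [B.B4 _ _ (hu3.trans hr.lt_ε).le (by
    rw [φ.apply_symm_apply]
    exact (hu2.trans hr.lt_ε).le), φ.apply_symm_apply] at h5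

end IsLabelling

end SmaleSpace

namespace SmaleSpace

/-! ### The quotient of a Smale space by a holonomy relation -/

variable {X : Type*} [MetricSpace X] {φ : X ≃ₜ X} {B : SmaleSpace φ} {r δ : ℝ} {α : Type*}
  {c : X → α}

namespace IsLabelling

/-- The holonomy relation of a labelling, as a setoid. -/
def holonomySetoid (h : B.IsLabelling r δ c) : Setoid X where
  r := B.HolonomyRel r c
  iseqv := ⟨h.rel_refl, h.rel_symm, h.rel_trans⟩

/-- The quotient by the holonomy relation, with the quotient topology. It need not be Hausdorff. -/
abbrev HolonomyQuot (h : B.IsLabelling r δ c) : Type _ := Quotient h.holonomySetoid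

/-- The projection to the quotient by the holonomy relation. -/
def proj (h : B.IsLabelling r δ c) (x : X) : h.HolonomyQuot := Quotient.mk h.holonomySetoid x

theorem proj_eq_iff (h : B.IsLabelling r δ c) {x y : X} :
    h.proj x = h.proj y ↔ B.HolonomyRel r c x y := Quotient.eq

theorem proj_surjective (h : B.IsLabelling r δ c) : Function.Surjective h.proj :=
  Quotient.mk_surjective

theorem continuous_proj (h : B.IsLabelling r δ c) : Continuous h.proj := continuous_quot_mk

theorem isOpenMap_proj (h : B.IsLabelling r δ c) : IsOpenMap h.proj := by
  intro O hO
  refine isQuotientMap_quot_mk.isOpen_preimage.1 (isOpen_iff_mem_nhds.2 fun y hy => ?_)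
  obtain ⟨z, hz, hzy⟩ := hy
  have hyz := h.proj_eq_iff.1 (Eq.symm hzy)
  filter_upwards [h.eventually_rel hyz, (h.tendsto_of_rel hyz).eventually (hO.mem_nhds hz)]
    with u hu huO
  exact ⟨_, huO, (h.proj_eq_iff.2 hu).symm⟩

/-- The map that `φ` induces on the quotient by the holonomy relation. -/
def quotMap (h : B.IsLabelling r δ c) : h.HolonomyQuot → h.HolonomyQuot :=
  Quotient.map φ fun _ _ hxy => h.rel_map hxy

theorem quotMap_proj (h : B.IsLabelling r δ c) (x : X) : h.quotMap (h.proj x) = h.proj (φ x) :=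
  rfl

theorem quotMap_iterate_proj (h : B.IsLabelling r δ c) (n : ℕ) (x : X) :
    h.quotMap^[n] (h.proj x) = h.proj (φ^[n] x) := by
  induction n generalizing x with
  | zero => rfl
  | succ n ih => exact ih (φ x)

theorem continuous_quotMap (h : B.IsLabelling r δ c) : Continuous h.quotMap :=
  continuous_quot_lift _ (h.continuous_proj.comp φ.continuous)

theorem surjective_quotMap (h : B.IsLabelling r δ c) : Function.Surjective h.quotMap := by
  intro q
  obtain ⟨x, rfl⟩ := h.proj_surjective q
  exact ⟨h.proj (φ.symm x), by rw [quotMap_proj, φ.apply_symm_apply]⟩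

theorem isOpenMap_quotMap (h : B.IsLabelling r δ c) : IsOpenMap h.quotMap := by
  intro V hV
  have : h.quotMap '' V = h.proj '' (φ '' (h.proj ⁻¹' V)) := by
    ext q
    constructor
    · rintro ⟨p, hp, rfl⟩
      obtain ⟨x, rfl⟩ := h.proj_surjective p
      exact ⟨φ x, ⟨x, hp, rfl⟩, rfl⟩
    · rintro ⟨_, ⟨x, hx, rfl⟩, rfl⟩
      exact ⟨h.proj x, hx, rfl⟩
  rw [this]
  exact h.isOpenMap_proj _ (φ.isOpenMap _ (hV.preimage h.continuous_proj))

/-- Nearby points are related to their projections to a common local unstable set. -/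
theorem exists_forall_rel_bracket [CompactSpace X] (h : B.IsLabelling r δ c) :
    ∃ τ > 0, τ ≤ r / 8 ∧ ∀ x u, dist x u < τ → dist x (B.bracket u x) < r / 8 ∧
      B.HolonomyRel r c u (B.bracket u x) := by
  have hrpos := h.small.pos
  obtain ⟨τ, hτ, hb⟩ := B.exists_dist_bracket_lt
    (half_pos (lt_min h.pos (by linarith : 0 < r / 8)))
  refine ⟨min τ (min (δ / 2) (r / 8)),
    lt_min hτ (lt_min (half_pos h.pos) (by linarith)),
    (min_le_right _ _).trans (min_le_right _ _), fun x u hxu => ?_⟩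
  have h1 := hb x u x (hxu.trans_le (min_le_left _ _)) (by rwa [dist_self])
  have h2 : dist x u < δ / 2 := hxu.trans_le ((min_le_right _ _).trans (min_le_left _ _))
  have h3 : dist u x < r := by rw [dist_comm]; linarith [h.le]
  refine ⟨by linarith [min_le_right δ (r / 8)], h.rel_of_stable ?_
    (h.small.bracket_bracket_right (by rwa [dist_self]) h3 h3)⟩
  linarith [dist_triangle_left u (B.bracket u x) x, min_le_left δ (r / 8)]

/-- The projections of `u` and `v` to the local unstable set of `x` lie on a common local unstable
set. -/
theorem bracket_bracket_bracket (h : B.IsLabelling r δ c) {x u v : X} (hu : dist x u < r / 8)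
    (hv : dist x v < r / 8) (hvx : dist x (B.bracket v x) < r / 8) :
    B.bracket (B.bracket u x) (B.bracket v x) = B.bracket u x := by
  have hrpos := h.small.pos
  have hux : dist u x < r := by rw [dist_comm]; linarith
  rw [h.small.bracket_bracket_left hux, h.small.bracket_bracket_right _ _ hux]
  · linarith [dist_triangle_left u v x]
  · rw [dist_comm]; linarith
  · linarith [dist_triangle_left u (B.bracket v x) x]

theorem isLocalHomeomorph_quotMap [CompactSpace X] (h : B.IsLabelling r δ c) :
    IsLocalHomeomorph h.quotMap := by
  obtain ⟨τ, hτ, hτr, hb⟩ := h.exists_forall_rel_bracket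
  have hrpos := h.small.pos
  have hlt := h.small.lt_ε
  refine isLocalHomeomorph_iff_isOpenEmbedding_restrict.2 fun q => ?_
  obtain ⟨x, rfl⟩ := h.proj_surjective q
  have hU : IsOpen (h.proj '' Metric.ball x τ) := h.isOpenMap_proj _ Metric.isOpen_ball
  refine ⟨_, hU.mem_nhds (mem_image_of_mem _ (Metric.mem_ball_self hτ)),
    IsOpenEmbedding.of_continuous_injective_isOpenMap
      (h.continuous_quotMap.comp continuous_subtype_val) ?_ (h.isOpenMap_quotMap.domRestrict hU)⟩
  rintro ⟨_, u, hu, rfl⟩ ⟨_, v, hv, rfl⟩ huv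
  rw [Metric.mem_ball, dist_comm] at hu hv
  obtain ⟨hu1, hu2⟩ := hb x u hu
  obtain ⟨hv1, hv2⟩ := hb x v hv
  have hdd : dist (B.bracket u x) (B.bracket v x) < r := by
    linarith [dist_triangle_left (B.bracket u x) (B.bracket v x) x]
  have hun := h.bracket_bracket_bracket (hu.trans_le hτr) (hv.trans_le hτr) hv1
  -- The projections of `u` and `v` to the local unstable set of `x` have related images, which
  -- lie on a common local unstable set and a common local stable set.
  have hrel : B.HolonomyRel r c (φ (B.bracket u x)) (φ (B.bracket v x)) :=
    h.rel_trans (h.rel_symm (h.rel_map hu2))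
      (h.rel_trans (h.proj_eq_iff.1 huv) (h.rel_map hv2))
  have heq : B.bracket u x = B.bracket v x := by
    have h1 := B.B4 _ _ (hdd.trans hlt).le (hrel.1.trans hlt).le
    rw [hun, hrel.2.1] at h1
    exact φ.injective h1
  refine Subtype.ext (h.proj_eq_iff.2 (h.rel_trans hu2 ?_))
  rw [heq]
  exact h.rel_symm hv2

theorem forwardOrbitExpansive_quotMap [CompactSpace X] (h : B.IsLabelling r δ c) :
    ForwardOrbitExpansive h.quotMap := by
  obtain ⟨τ, hτ, hτr, hb⟩ := h.exists_forall_rel_bracket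
  have hrpos := h.small.pos
  obtain ⟨t, -, htf, ht⟩ := finite_cover_balls_of_compact (isCompact_univ (X := X)) hτ
  have : Finite t := htf
  obtain ⟨l, ⟨e⟩⟩ := Finite.exists_equiv_fin t
  refine ⟨l, fun i => h.proj '' Metric.ball (e.symm i).1 τ,
    fun i => h.isOpenMap_proj _ Metric.isOpen_ball, eq_univ_of_forall fun q => ?_, ?_⟩
  · obtain ⟨x, rfl⟩ := h.proj_surjective q
    have hx := ht (mem_univ x)
    simp only [mem_iUnion] at hx
    obtain ⟨y, hy, hxy⟩ := hx
    exact mem_iUnion.2 ⟨e ⟨y, hy⟩, x, by simpa using hxy, rfl⟩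
  · intro p q hpq
    -- Representatives `a`, `b` of `p`, `q` on a common local unstable set have forward orbits
    -- that stay close, hence lie on a common local stable set as well.
    obtain ⟨i, ⟨u, hu, rfl⟩, ⟨v, hv, rfl⟩⟩ := hpq 0
    set x := (e.symm i).1
    rw [Metric.mem_ball, dist_comm] at hu hv
    obtain ⟨hu1, hu2⟩ := hb x u hu
    obtain ⟨hv1, hv2⟩ := hb x v hv
    have hun := h.bracket_bracket_bracket (hu.trans_le hτr) (hv.trans_le hτr) hv1
    set a := B.bracket u x
    set b := B.bracket v x
    have ha := h.proj_eq_iff.2 hu2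
    have hb' := h.proj_eq_iff.2 hv2
    rw [ha, hb'] at hpq ⊢
    have hclose : ∀ n : ℕ, dist (φ^[n] a) (φ^[n] b) < r := by
      intro n
      obtain ⟨j, ⟨a', ha', haa⟩, ⟨b', hbb', hbb⟩⟩ := hpq n
      rw [quotMap_iterate_proj] at haa hbb
      have h1 := h.dist_lt_of_rel (h.proj_eq_iff.1 haa)
      have h2 := h.dist_lt_of_rel (h.proj_eq_iff.1 hbb)
      rw [Metric.mem_ball] at ha' hbb'
      have h3 := dist_triangle_right a' b' (e.symm j).1
      have h4 := dist_triangle4 (φ^[n] a) a' b' (φ^[n] b)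
      rw [dist_comm] at h1
      linarith
    have hst := h.small.stable_of_forall_dist_lt hclose
    rw [hun] at hst
    rw [hst]

/-! ### Recovering the Smale space from the quotient -/

/-- The map `x ↦ ([x], [φ⁻¹ x], [φ⁻² x], …)` from a Smale space to the inverse limit of the
quotient by the holonomy relation. -/
def toInverseLimit (h : B.IsLabelling r δ c) (x : X) : InverseLimit h.quotMap :=
  ⟨fun n => h.proj (φ.symm^[n] x), fun n => by
    rw [quotMap_proj, Function.iterate_succ_apply', φ.apply_symm_apply]⟩

theorem iterate_symm_iterate (n : ℕ) (x : X) : φ^[n] (φ.symm^[n] x) = x :=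
  (Function.RightInverse.iterate φ.apply_symm_apply n) x

theorem symm_iterate_iterate (n : ℕ) (x : X) : φ.symm^[n] (φ^[n] x) = x :=
  (Function.LeftInverse.iterate φ.symm_apply_apply n) x

/-- Related points are exponentially close after `n` iterations. -/
theorem dist_le_of_rel (h : B.IsLabelling r δ c) {x y : X} (n : ℕ)
    (hxy : B.HolonomyRel r c x y) : dist (φ^[n] x) (φ^[n] y) ≤ B.lam ^ n * r :=
  (stable_iterate (hxy.1.trans h.small.lt_ε).le hxy.2.1 n).2.trans
    (mul_le_mul_of_nonneg_left hxy.1.le (pow_pos B.lam_pos n).le)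

theorem injective_toInverseLimit (h : B.IsLabelling r δ c) :
    Function.Injective h.toInverseLimit := by
  intro x y hxy
  refine dist_le_zero.1 (ge_of_tendsto' (B.tendsto_lam_pow_mul r) fun n => ?_)
  have h1 := h.dist_le_of_rel n (h.proj_eq_iff.1 (congrFun (congrArg Subtype.val hxy) n))
  rwa [iterate_symm_iterate, iterate_symm_iterate] at h1

/-- A limit of points that are all related to `y` is related to `y`. -/
theorem rel_of_tendsto (h : B.IsLabelling r δ c) {y z : X} {u : ℕ → X}
    (hu : Tendsto u atTop (𝓝 z)) (huy : ∀ n, B.HolonomyRel r c (u n) y) :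
    B.HolonomyRel r c z y := by
  obtain ⟨N, hN⟩ := (hu.eventually (Metric.ball_mem_nhds z h.pos)).exists
  have hzN : dist z (u N) < δ := by rw [dist_comm]; exact hN
  have hst : B.bracket z (u N) = u N := by
    have h1 := (B.tendsto_bracket_left (hzN.trans_le (h.le.trans h.small.lt_ε.le))).comp hu
    refine tendsto_nhds_unique h1 (tendsto_const_nhds.congr fun n => ?_)
    exact ((h.rel_trans (huy n) (h.rel_symm (huy N))).2.1).symm
  exact h.rel_trans (h.rel_of_stable hzN hst) (huy N)

theorem surjective_toInverseLimit [CompactSpace X] (h : B.IsLabelling r δ c) :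
    Function.Surjective h.toInverseLimit := by
  intro q
  choose x hx using fun n => h.proj_surjective (q.1 n)
  have hrel : ∀ n, B.HolonomyRel r c (φ (x (n + 1))) (x n) := fun n => by
    rw [← h.proj_eq_iff, ← quotMap_proj, hx, hx, q.2]
  have hrel' : ∀ m n, B.HolonomyRel r c (φ^[m] (x (n + m))) (x n) := by
    intro m
    induction m with
    | zero => exact fun n => h.rel_refl _
    | succ m ih =>
      intro n
      have h1 := h.rel_map (ih (n + 1))
      rw [← Function.iterate_succ_apply' φ, Nat.add_right_comm] at h1
      exact h.rel_trans h1 (hrel n)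
  have hcauchy : CauchySeq fun n => φ^[n] (x n) := by
    refine cauchySeq_of_le_geometric B.lam r B.lam_lt_one fun n => ?_
    rw [mul_comm, dist_comm, Function.iterate_succ_apply]
    exact h.dist_le_of_rel n (hrel n)
  obtain ⟨a, ha⟩ := cauchySeq_tendsto_of_complete hcauchy
  refine ⟨a, Subtype.ext (funext fun k => ?_)⟩
  change h.proj (φ.symm^[k] a) = q.1 k
  rw [← hx k, h.proj_eq_iff]
  have h1 := ((φ.symm.continuous.iterate k).tendsto a).comp ((tendsto_add_atTop_iff_nat k).2 ha)
  refine h.rel_of_tendsto h1 fun n => ?_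
  have h2 : φ.symm^[k] (φ^[n + k] (x (n + k))) = φ^[n] (x (k + n)) := by
    rw [add_comm n k, Function.iterate_add_apply, symm_iterate_iterate]
  have h3 := hrel' n k
  rw [← h2] at h3
  exact h3

theorem continuous_toInverseLimit (h : B.IsLabelling r δ c) : Continuous h.toInverseLimit :=
  Continuous.subtype_mk (continuous_pi fun n =>
    h.continuous_proj.comp (φ.symm.continuous.iterate n)) _

theorem isOpenMap_toInverseLimit [CompactSpace X] (h : B.IsLabelling r δ c) :
    IsOpenMap h.toInverseLimit := by
  intro O hO
  refine isOpen_iff_mem_nhds.2 ?_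
  rintro _ ⟨a, ha, rfl⟩
  obtain ⟨ρ, hρ, hρO⟩ := Metric.isOpen_iff.1 hO a ha
  obtain ⟨n, hn⟩ := ((B.tendsto_lam_pow_mul r).eventually (gt_mem_nhds (half_pos hρ))).exists
  -- A neighbourhood of the `n`-th coordinate determines the point up to `ρ`.
  have hW : IsOpen {v | dist (φ^[n] v) a < ρ / 2} :=
    isOpen_lt ((φ.continuous.iterate n).dist continuous_const) continuous_const
  have hV := (h.isOpenMap_proj _ hW).preimage
    ((continuous_apply n).comp (continuous_subtype_val (p := fun x : ℕ → h.HolonomyQuot =>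
      ∀ i, h.quotMap (x (i + 1)) = x i)))
  refine mem_of_superset (hV.mem_nhds ⟨φ.symm^[n] a, ?_, rfl⟩) ?_
  · rw [mem_ofPred_eq, iterate_symm_iterate, dist_self]
    exact half_pos hρ
  · rintro ξ ⟨v, hv, hvξ⟩
    obtain ⟨b, rfl⟩ := h.surjective_toInverseLimit ξ
    refine ⟨b, hρO ?_, rfl⟩
    have h1 := h.dist_le_of_rel n (h.proj_eq_iff.1 hvξ)
    rw [iterate_symm_iterate] at h1
    have hv' : dist (φ^[n] v) a < ρ / 2 := hv
    rw [Metric.mem_ball]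
    linarith [dist_triangle_left b a (φ^[n] v)]

theorem isConjugacy_toInverseLimit [CompactSpace X] (h : B.IsLabelling r δ c) :
    IsConjugacy φ (shift h.quotMap) h.toInverseLimit := by
  refine ⟨⟨h.continuous_toInverseLimit, h.isOpenMap_toInverseLimit, h.injective_toInverseLimit,
    h.surjective_toInverseLimit⟩, fun x => Subtype.ext (funext fun n => ?_)⟩
  have hcomm : Function.Commute φ.symm φ := fun x => by
    rw [φ.symm_apply_apply, φ.apply_symm_apply]
  exact congrArg h.proj (hcomm.iterate_left n x)

end IsLabelling

end SmaleSpace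

end Wieler

theorem mainTheorem2 :
    -- The quotient `X^u(P)/∼₀` of a Wieler solenoid
    (∀ (Y : Type u) [MetricSpace Y] [CompactSpace Y] [Infinite Y] (g : Y → Y)
      (β γ : ℝ) (K : ℕ) (_ : WielerAxioms g β γ K)
      (P : Set (InverseLimit g)) (_ : P.Finite) (hP : shift g '' P = P)
      (_ : ∀ p ∈ P, p ∈ Function.periodicPts (shift g))
      (εY : ℝ) (_ : 0 < εY) (_ : εY ≤ β / 2),
      (IsIrreducibleSystem (shift g) → P.Nonempty → Dense (unstableSet γ K P)) ∧
      (Dense (unstableSet γ K P) →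
        Equivalence (SimZero (γ := γ) (K := K) (P := P) εY) ∧
        Continuous (rMap γ K P εY) ∧ Function.Surjective (rMap γ K P εY) ∧
        (∃ K₀ : ℕ, 0 < K₀ ∧ ∀ x y : XuP γ K P,
          (∀ i ≤ K₀, x.val.1 i = y.val.1 i) → SimZero εY x y) ∧
        ∃ gt : XuPQuot γ K P εY → XuPQuot γ K P εY,
          (∀ x : XuP γ K P, gt (cls εY x) = cls εY (shiftU hP x)) ∧
          Continuous gt ∧
          ∀ K₀ : ℕ, (∀ x y : XuP γ K P,
              (∀ i ≤ K₀, x.val.1 i = y.val.1 i) → SimZero εY x y) →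
            ∃ s : Y → XuPQuot γ K P εY,
              (∀ (y : Y) (z : XuP γ K P),
                (∀ i ≤ K₀, z.val.1 i = g^[K₀ - i] y) → s y = cls εY z) ∧
              IsShiftEquivalence gt g (rMap γ K P εY) s K₀ ∧
              ∃ S : InverseLimit g → InverseLimit gt,
                (∀ x n, (S x).1 n = s (x.1 n)) ∧
                IsConjugacy (shift g) (shift gt) S)) ∧
    -- Irreducible Smale spaces with totally disconnected stable sets
    (∀ (X : Type v) [MetricSpace X] [CompactSpace X] [Infinite X] (φ : X ≃ₜ X)
      (B : SmaleSpace φ), IsIrreducibleSystem φ →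
      (∀ x : X, TotallyDisconnectedSpace (B.StableSet x)) →
      ∃ (Yt : Type v) (_ : TopologicalSpace Yt) (gt : Yt → Yt),
        CompactSpace Yt ∧ IsLocalHomeomorph gt ∧ Function.Surjective gt ∧
        ForwardOrbitExpansive gt ∧
        ∃ S : X → InverseLimit gt, IsConjugacy φ (shift gt) S) := by
  refine ⟨?_, ?_⟩
  · intro Y _ _ _ g β γ K hW P _ hP _ εY hε hεβ
    refine ⟨hW.dense_unstableSet hP, fun hd => ⟨simZero_equivalence hW hε hεβ, hW.continuous_rMap,
      hW.surjective_rMap hd, ⟨K, hW.K_pos, fun x y h => hW.simZero_of_coord_eq hε hεβ h⟩,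
      quotShift hW hε hεβ hP, fun x => rfl, continuous_quotShift hW hε hεβ hP,
      fun K₀ hK₀ => ?_⟩⟩
    obtain ⟨s, hs, hse⟩ := exists_isShiftEquivalence hW hε hεβ hP hd K₀ hK₀
    exact ⟨s, hs, hse, hse.exists_isConjugacy⟩
  · intro X _ _ _ φ B _ hB
    obtain ⟨r, hr⟩ := B.exists_isSmall
    obtain ⟨δ, c, h⟩ := hr.exists_isLabelling hB
    exact ⟨h.HolonomyQuot, inferInstance, h.quotMap, inferInstance, h.isLocalHomeomorph_quotMap,
      h.surjective_quotMap, h.forwardOrbitExpansive_quotMap, h.toInverseLimit,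
      h.isConjugacy_toInverseLimit⟩
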